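/- **Setting.** Let $L>0$, $\omega_0>0$, $\alpha\ge 0$, $v\in\mathbb R$, $f\in C^2(\mathbb R)$, and let $X,V\in C^4(\mathbb R)$ be $L$-periodic with $X>0$, $\int_0^L X(u)\,du=L$ and $\int_0^L V(u)\,du=0$. For every sufficiently large $N$ let $x^{(N)}_k(t)$, $k\in\mathbb Z$, $t\ge 0$, satisfy $x^{(N)}_{k+N}=x^{(N)}_k+L$ and $$\ddot x^{(N)}_k=(\omega_0N)^2\bigl(x^{(N)}_{k+1}-2x^{(N)}_k+x^{(N)}_{k-1}\bigr)-\alpha\dot x^{(N)}_k+f(t),\qquad t\ge 0,$$ with $x_0^{(N)}(0)=0$, $x_k^{(N)}(0)<x_{k+1}^{(N)}(0)$ for all $k$, $\dot x_0^{(N)}(0)=v$ (the same $v$ for all $N$), and, with constants $C_1,C_2>0$ independent of $N$ and $k$, $$\Bigl|x^{(N)}_{k+1}(0)-x^{(N)}_{k}(0)-\tfrac LN X\bigl(\tfrac{kL}N\bigr)\Bigr|<\frac{C_1}{N^2},\qquad \Bigl|\dot x^{(N)}_{k+1}(0)-\dot x^{(N)}_{k}(0)-\tfrac LN V\bigl(\tfrac{kL}N\bigr)\Bigr|<\frac{C_2}{N^2}.$$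 Assume moreover that $\gamma<\delta$ for some $\delta\in(0,1)$, where $$\gamma=\Bigl(1+\frac{\alpha}{8\omega_0}\Bigr)\bigl(2c_1+C_1L^{-1}\bigr)+\frac{2c_2+C_2L^{-1}}{4\omega_0},\qquad c_1=L\int_0^L|X''(u)|\,du,\quad c_2=L\int_0^L|V''(u)|\,du .$$ For $x\in\mathbb R$ let $k(x,N)$ be the index with $x^{(N)}_{k(x,N)}(0)\le x<x^{(N)}_{k(x,N)+1}(0)$. Let $z(x)$ be defined by $\int_0^{z(x)}X(u)\,du=x$, let $x(z)$ be the inverse function of $z(x)$, and put $\omega_1=\omega_0L$. **Theorem.** The functions $z(x)$ and $x(z)$ are well-defined mutually inverse bijections of $\mathbb R$. The limit $$Y(t,x)=\lim_{N\to\infty}x^{(N)}_{k(x,N)}(t)$$ exists for all $t\ge0$, $x\in\mathbb R$, uniformly in $t\in[0,T]$ and $x\in\mathbb R$ for every $T>0$. The functions $Y(t,x)$ and $G(t,z)=Y(t,x(z))$ are of class $C^2$ on $[0,\infty)\times\mathbb R$ (time derivatives at $t=0$ being one-sided), and: 1. for all $t\ge0$, $z\in\mathbb R$, $$Y_{tt}(t,x(z))=\omega_1^2\bigl(Y_{xx}(t,x(z))X^2(z)+Y_x(t,x(z))X'(z)\bigr)-\alpha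 Y_t(t,x(z))+f(t),$$ with initial conditions $$Y(0,x(z))=x(z)=\int_0^zX(u)\,du=G(0,z),\qquad Y_t(0,x(z))=v+\int_0^zV(u)\,du;$$ 2. for all $t\ge0$, $z\in\mathbb R$, $$G_{tt}(t,z)=\omega_1^2G_{zz}(t,z)-\alpha G_t(t,z)+f(t);$$ 3. if $\alpha=0$ and $f(t)=0$ for all $t\ge0$, then $Y$ satisfies the classical wave equation $Y_{tt}(t,x)=\omega_1^2Y_{xx}(t,x)$ for all $t\ge0$, $x\in\mathbb R$ if and only if $X\equiv1$. -/

import Mathlib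

open Set Filter Topology

noncomputable section

namespace OscillatorChain

/-- Time derivative of a function on the half-line `[0, ∞)` (one-sided at `0`). -/
def timeDeriv (y : ℝ → ℝ) (t : ℝ) : ℝ := derivWithin y (Ici 0) t

/-- `x k t` is the position at time `t ≥ 0` of particle `k` of an `L`-periodic chain with `N`
particles per period: the particles are strictly ordered at time `0`, with particle `0` at the
origin, and they move by Newton's equations
`x_k'' = ω² (x_{k+1} - 2 x_k + x_{k-1}) - α x_k' + f(t)` for all `t ≥ 0`. -/
structure IsChain (N : ℕ) (L ω α : ℝ) (f : ℝ → ℝ) (x : ℤ → ℝ → ℝ) : Prop where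
  pos : 0 < N
  periodic : ∀ k : ℤ, ∀ t : ℝ, 0 ≤ t → x (k + N) t = x k t + L
  initial_zero : x 0 0 = 0
  initial_lt : ∀ k : ℤ, x k 0 < x (k + 1) 0
  differentiable : ∀ k : ℤ, DifferentiableOn ℝ (x k) (Ici 0)
  newton : ∀ k : ℤ, ∀ t : ℝ, 0 ≤ t →
    HasDerivWithinAt (timeDeriv (x k))
      (ω ^ 2 * (x (k + 1) t - 2 * x k t + x (k - 1) t) - α * timeDeriv (x k) t + f t) (Ici 0) t

/-- `X` and `V` are admissible profiles: `C⁴`, `L`-periodic, `X > 0`, with means `1` and `0`. -/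
structure IsProfile (L : ℝ) (X V : ℝ → ℝ) : Prop where
  contDiff_X : ContDiff ℝ 4 X
  contDiff_V : ContDiff ℝ 4 V
  periodic_X : Function.Periodic X L
  periodic_V : Function.Periodic V L
  pos_X : ∀ u : ℝ, 0 < X u
  integral_X : ∫ u in (0 : ℝ)..L, X u = L
  integral_V : ∫ u in (0 : ℝ)..L, V u = 0

/-- The initial spacings and relative velocities of the chain `x` follow the profiles `X`, `V`
up to `C₁ / N²` and `C₂ / N²`, uniformly in the particle number. -/
structure FollowsProfile (N : ℕ) (L : ℝ) (X V : ℝ → ℝ) (C₁ C₂ : ℝ) (x : ℤ → ℝ → ℝ) : Prop where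
  position : ∀ k : ℤ,
    |x (k + 1) 0 - x k 0 - L / N * X (k * L / N)| < C₁ / (N : ℝ) ^ 2
  velocity : ∀ k : ℤ,
    |timeDeriv (x (k + 1)) 0 - timeDeriv (x k) 0 - L / N * V (k * L / N)| < C₂ / (N : ℝ) ^ 2

/-- The fluctuation constant `L ∫₀ᴸ |h''(u)| du` of a profile `h`. -/
def fluct (L : ℝ) (h : ℝ → ℝ) : ℝ := L * ∫ u in (0 : ℝ)..L, |iteratedDeriv 2 h u|

/-- The constant `γ` whose smallness excludes collisions. -/
def gammaConst (L ω₀ α : ℝ) (X V : ℝ → ℝ) (C₁ C₂ : ℝ) : ℝ :=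
  (1 + α / (8 * ω₀)) * (2 * fluct L X + C₁ * L⁻¹) + (2 * fluct L V + C₂ * L⁻¹) / (4 * ω₀)

/-- The number `k` of the particle with `x_k(0) ≤ y < x_{k+1}(0)`. -/
def particleAt (x : ℤ → ℝ → ℝ) (y : ℝ) : ℤ :=
  Classical.epsilon fun k : ℤ => x k 0 ≤ y ∧ y < x (k + 1) 0

/-- For a chain, `particleAt` is the one and only index with the required property. -/
theorem IsChain.particleAt_spec {N : ℕ} {L ω α : ℝ} {f : ℝ → ℝ} {x : ℤ → ℝ → ℝ}
    (hx : IsChain N L ω α f x) (y : ℝ) (k : ℤ) :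
    (x k 0 ≤ y ∧ y < x (k + 1) 0) ↔ k = particleAt x y := by
  have hmono : StrictMono fun k : ℤ => x k 0 := strictMono_int_of_lt_succ hx.initial_lt
  have hNpos : (0 : ℤ) < N := by exact_mod_cast hx.pos
  have hL : 0 < L := by
    have h1 := hx.periodic 0 0 le_rfl
    have h2 : x 0 0 < x (0 + N) 0 := hmono (by omega)
    linarith
  have hper : ∀ m : ℕ, x (m * N) 0 = m * L ∧ x (-(m * N)) 0 = -(m * L) := by
    intro m
    induction m with
    | zero => simp [hx.initial_zero]
    | succ m ih =>
      have h1 := hx.periodic (m * N) 0 le_rfl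
      have h2 := hx.periodic (-((m + 1) * N)) 0 le_rfl
      have e1 : ((m : ℤ) * N + N) = (m + 1) * N := by ring
      have e2 : (-(((m : ℤ) + 1) * N) + N) = -(m * N) := by ring
      rw [e1, ih.1] at h1
      rw [e2, ih.2] at h2
      push_cast
      exact ⟨by linarith, by linarith⟩
  have hex : ∃ k : ℤ, x k 0 ≤ y ∧ y < x (k + 1) 0 := by
    obtain ⟨m, hm⟩ := exists_nat_gt (|y| / L)
    have hm' : |y| < m * L := (div_lt_iff₀ hL).1 hm
    obtain ⟨h1, h2⟩ := hper m
    obtain ⟨k, hk, hk'⟩ := Int.exists_greatest_of_bdd (P := fun k : ℤ => x k 0 ≤ y)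
      ⟨m * N, fun k hk => by
        by_contra! hlt
        have : x (m * N) 0 < x k 0 := hmono hlt
        linarith [le_abs_self y]⟩
      ⟨-(m * N), by linarith [neg_abs_le y]⟩
    refine ⟨k, hk, ?_⟩
    by_contra! hle
    have := hk' _ hle
    omega
  have hspec : x (particleAt x y) 0 ≤ y ∧ y < x (particleAt x y + 1) 0 :=
    Classical.epsilon_spec hex
  constructor
  · rintro ⟨h1, h2⟩
    have a1 : k < particleAt x y + 1 := hmono.lt_iff_lt.1 (lt_of_le_of_lt h1 hspec.2)
    have a2 : particleAt x y < k + 1 := hmono.lt_iff_lt.1 (lt_of_le_of_lt hspec.1 h2)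
    omega
  · rintro rfl
    exact hspec

/-- The function `z(x)` defined by `∫₀^{z(x)} X(u) du = x`. -/
def zOfX (X : ℝ → ℝ) : ℝ → ℝ := Function.invFun fun z : ℝ => ∫ u in (0 : ℝ)..z, X u

/-- The function `x(z)`, inverse to `z(x)`. -/
def xOfZ (X : ℝ → ℝ) : ℝ → ℝ := Function.invFun (zOfX X)

/-- `Y(t, y)`, `t ≥ 0`, is the limit, uniform in `t ∈ [0, T]` (for every `T`) and in `y ∈ ℝ`, of
the position at time `t` of the particle which at time `0` is located at `y`. -/
def IsContinuumLimit (x : ℕ → ℤ → ℝ → ℝ) (Y : ℝ → ℝ → ℝ) : Prop :=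
  ∀ T : ℝ, 0 < T →
    TendstoUniformlyOn (fun (N : ℕ) (p : ℝ × ℝ) => x N (particleAt (x N) p.2) p.1)
      (fun p : ℝ × ℝ => Y p.1 p.2) atTop (Icc 0 T ×ˢ univ)

/-- `Y` is jointly `C²` on `[0, ∞) × ℝ`. -/
def IsC2 (Y : ℝ → ℝ → ℝ) : Prop :=
  ContDiffOn ℝ 2 (fun p : ℝ × ℝ => Y p.1 p.2) (Ici 0 ×ˢ univ)

/-- First partial derivative in `t` (one-sided at `t = 0`). -/
def Dt (Y : ℝ → ℝ → ℝ) (t x : ℝ) : ℝ := timeDeriv (fun s => Y s x) t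

/-- Second partial derivative in `t` (one-sided at `t = 0`). -/
def Dtt (Y : ℝ → ℝ → ℝ) (t x : ℝ) : ℝ := timeDeriv (fun s => Dt Y s x) t

/-- First partial derivative in the space variable. -/
def Dx (Y : ℝ → ℝ → ℝ) (t x : ℝ) : ℝ := deriv (fun y => Y t y) x

/-- Second partial derivative in the space variable. -/
def Dxx (Y : ℝ → ℝ → ℝ) (t x : ℝ) : ℝ := deriv (fun y => Dx Y t y) x

/-- The function `G(t, z) = Y(t, x(z))`. -/
def lagrange (X : ℝ → ℝ) (Y : ℝ → ℝ → ℝ) (t z : ℝ) : ℝ := Y t (xOfZ X z)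

end OscillatorChain

end

/-! The particle label `k` is replaced by the Lagrangian coordinate `z = kL/N`. In it, the elastic
force `(ω₀N)²` times a second difference of step `L/N` tends to `(ω₀L)² ∂_z²`, so the chain is a
finite difference scheme for `G_tt = ω₁² G_zz - α G_t + f`. The initial data of the limit are the
primitives of `X` and of `V` (plus `v`). The proof constructs `G` and shows that the scheme
converges to it.

Existence (`exists_dampedWave`): subtracting `z` and a function of time that absorbs `f` makes the
problem periodic and homogeneous. A factor `exp(-αt/2)` turns damping into a zeroth-order term,
leaving a Klein-Gordon equation, which a Riemann function of Bessel type solves explicitly.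

Convergence (`eventually_chain_close`): the samples `G(t, kL/N)` satisfy Newton's equations up to an
error controlled by the modulus of continuity of `G_zz`, uniform by periodicity. The initial errors
are `O(1/N)`, with differences `O(1/N²)`. An energy estimate (`chainEnergy_le`) keeps the energy of
the error at `o(N)`. Since the stiffness is of order `N²`, a discrete Sobolev inequality
(`abs_le_of_chainEnergy_le`) converts this into uniform smallness.

At time zero the chain is close to `x(z) = ∫₀ᶻ X`, whose slope is bounded below, so the particle
found at `y` has `kL/N` close to `z(y)`. Hence `Y(t, y) = G(t, z(y))`, and the equation for `Y`
follows by the chain rule. In the third claim, `Y(0, ·)` is the identity, so the classical wave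
equation at `t = 0` forces `X' = 0`. -/

namespace OscillatorChain

/-! ### Power series of modified Bessel type. -/

section Bessel

/-- The entire function `∑ wⁿ / (n! (n + k)!)`; up to rescaling, a modified Bessel function. -/
noncomputable def besselSeries (k : ℕ) (w : ℝ) : ℝ :=
  ∑' n : ℕ, w ^ n / ((n.factorial : ℝ) * ((n + k).factorial : ℝ))

theorem abs_besselSeries_term_le (k n : ℕ) {w R : ℝ} (hw : |w| ≤ R) :
    ‖w ^ n / ((n.factorial : ℝ) * ((n + k).factorial : ℝ))‖ ≤ R ^ n / (n.factorial : ℝ) := by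
  have h1 : (0 : ℝ) < n.factorial := by positivity
  have h2 : (1 : ℝ) ≤ ((n + k).factorial : ℝ) := by exact_mod_cast Nat.factorial_pos (n + k)
  rw [norm_div, norm_pow, Real.norm_eq_abs, Real.norm_eq_abs,
    abs_of_pos (by positivity : (0 : ℝ) < n.factorial * ((n + k).factorial : ℝ))]
  have h3 : |w| ^ n ≤ R ^ n := pow_le_pow_left₀ (abs_nonneg w) hw n
  have h4 : (n.factorial : ℝ) ≤ n.factorial * ((n + k).factorial : ℝ) :=
    le_mul_of_one_le_right h1.le h2
  exact div_le_div₀ (by linarith [pow_nonneg (abs_nonneg w) n]) h3 h1 h4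

theorem summable_besselSeries (k : ℕ) (w : ℝ) :
    Summable fun n : ℕ => w ^ n / ((n.factorial : ℝ) * ((n + k).factorial : ℝ)) :=
  Summable.of_norm_bounded (Real.summable_pow_div_factorial |w|)
    fun n => abs_besselSeries_term_le k n le_rfl

theorem besselSeries_zero_zero : besselSeries 0 0 = 1 := by
  unfold besselSeries
  rw [tsum_eq_single 0 (fun n hn => by simp [hn])]
  simp

theorem succ_term_eq (k n : ℕ) (w : ℝ) :
    ((n + 1 : ℕ) : ℝ) * w ^ n / (((n + 1).factorial : ℝ) * ((n + 1 + k).factorial : ℝ)) =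
      w ^ n / ((n.factorial : ℝ) * ((n + (k + 1)).factorial : ℝ)) := by
  rw [show n + 1 + k = n + (k + 1) by ring, Nat.factorial_succ n]
  have h1 : (n.factorial : ℝ) ≠ 0 := by positivity
  have h2 : ((n + (k + 1)).factorial : ℝ) ≠ 0 := by positivity
  have h3 : ((n + 1 : ℕ) : ℝ) ≠ 0 := by positivity
  push_cast at h3 ⊢
  field_simp

/-- Termwise differentiation only raises the shift `k` by one. The family is thus closed under
differentiation, and smoothness of all orders follows by induction. -/
theorem hasDerivAt_besselSeries (k : ℕ) (w : ℝ) :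
    HasDerivAt (besselSeries k) (besselSeries (k + 1) w) w := by
  -- Any radius beyond `|w|` works: on this ball the differentiated terms are dominated by a shifted
  -- exponential series.
  set R : ℝ := |w| + 1
  have hw : w ∈ Metric.ball (0 : ℝ) R := by simp [R]
  have hb : ∀ n : ℕ, ∀ y ∈ Metric.ball (0 : ℝ) R,
      ‖(n : ℝ) * y ^ (n - 1) / ((n.factorial : ℝ) * ((n + k).factorial : ℝ))‖
        ≤ n * R ^ (n - 1) / (n.factorial : ℝ) := by
    intro n y hy
    have hy' : |y| ≤ R := by
      rw [mem_ball_zero_iff] at hy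
      exact hy.le
    cases n with
    | zero => simp
    | succ n =>
      rw [Nat.add_sub_cancel, succ_term_eq]
      refine (abs_besselSeries_term_le (k + 1) n hy').trans (le_of_eq ?_)
      rw [Nat.factorial_succ]
      have h1 : (n.factorial : ℝ) ≠ 0 := by positivity
      have h3 : ((n + 1 : ℕ) : ℝ) ≠ 0 := by positivity
      push_cast at h3 ⊢
      field_simp
  have hu : Summable fun n : ℕ => n * R ^ (n - 1) / (n.factorial : ℝ) := by
    rw [← summable_nat_add_iff 1]
    refine (Real.summable_pow_div_factorial R).congr fun n => ?_
    rw [Nat.add_sub_cancel, Nat.factorial_succ]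
    have h1 : (n.factorial : ℝ) ≠ 0 := by positivity
    have h3 : ((n + 1 : ℕ) : ℝ) ≠ 0 := by positivity
    push_cast at h3 ⊢
    field_simp
  have key := hasDerivAt_tsum_of_isPreconnected
    (g := fun (n : ℕ) (y : ℝ) => y ^ n / ((n.factorial : ℝ) * ((n + k).factorial : ℝ)))
    (g' := fun (n : ℕ) (y : ℝ) =>
      (n : ℝ) * y ^ (n - 1) / ((n.factorial : ℝ) * ((n + k).factorial : ℝ)))
    hu Metric.isOpen_ball (convex_ball (0 : ℝ) R).isPreconnected
    (fun n y _ => (hasDerivAt_pow n y).div_const _) hb hw (summable_besselSeries k w) hw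
  convert! key using 1
  have hs : Summable fun n : ℕ =>
      (n : ℝ) * w ^ (n - 1) / ((n.factorial : ℝ) * ((n + k).factorial : ℝ)) :=
    Summable.of_norm_bounded hu fun n => hb n w hw
  rw [hs.tsum_eq_zero_add]
  simp only [Nat.add_sub_cancel, succ_term_eq]
  simp [besselSeries]

/-- Multiply and divide each term by `n + k + 1` and split that factor. As raising the shift is
differentiation, this is Bessel's equation `F = (k + 1) F' + w F''`. -/
theorem besselSeries_recurrence (k : ℕ) (w : ℝ) :
    besselSeries k w = (k + 1) * besselSeries (k + 1) w + w * besselSeries (k + 2) w := by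
  have hterm : ∀ n : ℕ, w ^ n / ((n.factorial : ℝ) * ((n + k).factorial : ℝ)) =
      (k + 1) * (w ^ n / ((n.factorial : ℝ) * ((n + (k + 1)).factorial : ℝ))) +
      n * w ^ n / ((n.factorial : ℝ) * ((n + (k + 1)).factorial : ℝ)) := by
    intro n
    rw [show n + (k + 1) = n + k + 1 by ring, Nat.factorial_succ (n + k)]
    have h1 : (n.factorial : ℝ) ≠ 0 := by positivity
    have h2 : ((n + k).factorial : ℝ) ≠ 0 := by positivity
    have h3 : ((n + k + 1 : ℕ) : ℝ) ≠ 0 := by positivity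
    push_cast at h3 ⊢
    field_simp
    ring
  have hs1 := (summable_besselSeries (k + 1) w).mul_left ((k : ℝ) + 1)
  have hs2 : Summable fun n : ℕ =>
      n * w ^ n / ((n.factorial : ℝ) * ((n + (k + 1)).factorial : ℝ)) :=
    ((summable_besselSeries k w).sub hs1).congr fun n => by rw [hterm n]; ring
  have e : ∀ n : ℕ, ((n + 1 : ℕ) : ℝ) * w ^ (n + 1) /
      (((n + 1).factorial : ℝ) * ((n + 1 + (k + 1)).factorial : ℝ)) =
      w * (w ^ n / ((n.factorial : ℝ) * ((n + (k + 2)).factorial : ℝ))) := by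
    intro n
    rw [← succ_term_eq (k + 1) n w, pow_succ]
    ring
  calc besselSeries k w = ∑' n : ℕ,
        ((k + 1) * (w ^ n / ((n.factorial : ℝ) * ((n + (k + 1)).factorial : ℝ))) +
        n * w ^ n / ((n.factorial : ℝ) * ((n + (k + 1)).factorial : ℝ))) := tsum_congr hterm
    _ = _ := by
      rw [hs1.tsum_add hs2, tsum_mul_left, hs2.tsum_eq_zero_add]
      simp only [e]
      rw [tsum_mul_left]
      simp [besselSeries]

theorem contDiff_besselSeries (n k : ℕ) : ContDiff ℝ n (besselSeries k) := by
  induction n generalizing k with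
  | zero =>
    exact contDiff_zero.2
      (continuous_iff_continuousAt.2 fun w => (hasDerivAt_besselSeries k w).continuousAt)
  | succ n ih =>
    have hd : deriv (besselSeries k) = besselSeries (k + 1) :=
      funext fun w => (hasDerivAt_besselSeries k w).deriv
    push_cast
    refine contDiff_succ_iff_deriv.2
      ⟨fun w => (hasDerivAt_besselSeries k w).differentiableAt, by simp, ?_⟩
    rw [hd]
    exact ih (k + 1)

end Bessel

/-! ### Differentiation of integrals with parameters. -/

section ParametricIntegral

/-- The dominating constant is a bound for the derivative on a closed unit ball times the interval,
compact because `E` is proper. -/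
theorem hasFDerivAt_intervalIntegral_of_continuous {E F : Type*} [NormedAddCommGroup E]
    [NormedSpace ℝ E] [ProperSpace E] [NormedAddCommGroup F] [NormedSpace ℝ F]
    {h : E → ℝ → F} {h' : E → ℝ → E →L[ℝ] F} (hc : Continuous (Function.uncurry h))
    (hc' : Continuous (Function.uncurry h')) (hd : ∀ p s, HasFDerivAt (fun q => h q s) (h' p s) p)
    (a b : ℝ) (p : E) :
    HasFDerivAt (fun q => ∫ s in a..b, h q s) (∫ s in a..b, h' p s) p := by
  obtain ⟨M, hM⟩ := ((isCompact_closedBall p 1).prod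
    (isCompact_uIcc (a := a) (b := b))).bddAbove_image hc'.norm.continuousOn
  have hsec : ∀ q, Continuous (h q) := fun q => hc.comp (by fun_prop : Continuous fun s => (q, s))
  have hsec' : ∀ q, Continuous (h' q) := fun q => hc'.comp (by fun_prop : Continuous fun s => (q, s))
  refine intervalIntegral.hasFDerivAt_integral_of_dominated_of_fderiv_le (F' := h')
    (bound := fun _ => M)
    (Metric.closedBall_mem_nhds p one_pos) (Eventually.of_forall fun q => ?_)
    ((hsec p).intervalIntegrable a b) ?_ ?_ ?_ (Eventually.of_forall fun s _ q _ => hd q s)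
  · exact (hsec q).aestronglyMeasurable
  · exact (hsec' p).aestronglyMeasurable
  · refine Eventually.of_forall fun s hs q hq => hM ⟨(q, s), ⟨hq, uIoc_subset_uIcc hs⟩, rfl⟩
  · exact intervalIntegrable_const

theorem hasDerivAt_intervalIntegral_of_continuous {h h' : ℝ → ℝ → ℝ}
    (hc : Continuous (Function.uncurry h)) (hc' : Continuous (Function.uncurry h'))
    (hd : ∀ t s, HasDerivAt (fun r => h r s) (h' t s) t) (a b t : ℝ) :
    HasDerivAt (fun r => ∫ s in a..b, h r s) (∫ s in a..b, h' t s) t := by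
  obtain ⟨M, hM⟩ := ((isCompact_closedBall t 1).prod
    (isCompact_uIcc (a := a) (b := b))).bddAbove_image hc'.norm.continuousOn
  have hsec : ∀ q, Continuous (h q) := fun q => hc.comp (by fun_prop : Continuous fun s => (q, s))
  have hsec' : ∀ q, Continuous (h' q) :=
    fun q => hc'.comp (by fun_prop : Continuous fun s => (q, s))
  refine (intervalIntegral.hasDerivAt_integral_of_dominated_loc_of_deriv_le (F' := h')
    (bound := fun _ => M)
    (Metric.closedBall_mem_nhds t one_pos) (Eventually.of_forall fun q => ?_)
    ((hsec t).intervalIntegrable a b) ?_ ?_ ?_ (Eventually.of_forall fun s _ q _ => hd q s)).2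
  · exact (hsec q).aestronglyMeasurable
  · exact (hsec' t).aestronglyMeasurable
  · exact Eventually.of_forall fun s hs q hq => hM ⟨(q, s), ⟨hq, uIoc_subset_uIcc hs⟩, rfl⟩
  · exact intervalIntegrable_const

theorem continuous_intervalIntegral_uncurry {h : ℝ → ℝ → ℝ} (hc : Continuous (Function.uncurry h)) :
    Continuous fun p : ℝ × ℝ => ∫ s in (0 : ℝ)..p.1, h p.2 s := by
  refine intervalIntegral.continuous_parametric_intervalIntegral_of_continuous
    (f := fun p : ℝ × ℝ => h p.2) ?_ continuous_fst
  exact hc.comp (by fun_prop : Continuous fun q : (ℝ × ℝ) × ℝ => (q.1.2, q.2))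

theorem continuous_toSpanSingleton :
    Continuous fun c : ℝ => ContinuousLinearMap.toSpanSingleton ℝ c := by
  have e : (fun c : ℝ => ContinuousLinearMap.toSpanSingleton ℝ c) =
      fun c : ℝ => c • ContinuousLinearMap.toSpanSingleton ℝ (1 : ℝ) := by
    funext c
    ext
    simp
  rw [e]
  fun_prop

/-- The Leibniz rule for `∫₀ᵗ h(t, s) ds`. -/
theorem hasDerivAt_integral_leibniz {h h' : ℝ → ℝ → ℝ}
    (hc : Continuous (Function.uncurry h)) (hc' : Continuous (Function.uncurry h'))
    (hd : ∀ t s, HasDerivAt (fun r => h r s) (h' t s) t) (t : ℝ) :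
    HasDerivAt (fun r => ∫ s in (0 : ℝ)..r, h r s) (h t t + ∫ s in (0 : ℝ)..t, h' t s) t := by
  have hsec : ∀ q, Continuous (h q) := fun q => hc.comp (by fun_prop : Continuous fun s => (q, s))
  have hcs : Continuous fun p : ℝ × ℝ => h p.2 p.1 :=
    hc.comp (by fun_prop : Continuous fun p : ℝ × ℝ => (p.2, p.1))
  -- Separate the endpoint `a` from the parameter `r`. Both partial derivatives are continuous, so
  -- the function of `(a, r)` is differentiable, and it is then restricted to the diagonal.
  have key := hasStrictFDerivAt_uncurry_coprod (𝕜 := ℝ) (u := (t, t))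
    (f := fun a r => ∫ s in (0 : ℝ)..a, h r s)
    (f₁ := fun a r => ContinuousLinearMap.toSpanSingleton ℝ (h r a))
    (f₂ := fun a r => ContinuousLinearMap.toSpanSingleton ℝ (∫ s in (0 : ℝ)..a, h' r s))
    (Eventually.of_forall fun v =>
      ((hsec v.2).integral_hasStrictDerivAt 0 v.1).hasDerivAt.hasFDerivAt)
    (Eventually.of_forall fun v =>
      (hasDerivAt_intervalIntegral_of_continuous hc hc' hd 0 v.1 v.2).hasFDerivAt)
    (continuous_toSpanSingleton.comp hcs).continuousAt
    (continuous_toSpanSingleton.comp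
      (continuous_intervalIntegral_uncurry hc')).continuousAt
  have hdiag : HasDerivAt (fun r : ℝ => (r, r)) ((1 : ℝ), (1 : ℝ)) t :=
    (hasDerivAt_id t).prodMk (hasDerivAt_id t)
  have := HasFDerivAt.comp_hasDerivAt (f := fun r : ℝ => (r, r)) t key.hasFDerivAt hdiag
  convert! this using 1
  simp [Function.HasUncurry.uncurry]

/-- The induction changes `F`, since the derivative takes values in a space of linear maps; with `E`
and `F` in `Type` the universe stays the same. -/
theorem contDiff_intervalIntegral {E F : Type} [NormedAddCommGroup E]
    [NormedSpace ℝ E] [ProperSpace E] [NormedAddCommGroup F] [NormedSpace ℝ F] (n : ℕ)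
    {h : E × ℝ → F} (hh : ContDiff ℝ n h) (a b : ℝ) :
    ContDiff ℝ n fun p => ∫ s in a..b, h (p, s) := by
  induction n generalizing F with
  | zero =>
    refine contDiff_zero.2 ?_
    exact intervalIntegral.continuous_parametric_intervalIntegral_of_continuous'
      (f := fun p s => h (p, s)) (contDiff_zero.1 hh) a b
  | succ n ih =>
    push_cast at hh ⊢
    obtain ⟨h', hh', hd⟩ := contDiff_succ_iff_hasFDerivAt.1 hh
    refine contDiff_succ_iff_hasFDerivAt.2
      ⟨fun p => ∫ s in a..b, (h' (p, s)).comp (ContinuousLinearMap.inl ℝ E ℝ), ?_, fun p => ?_⟩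
    · exact ih (h := fun q => (h' q).comp (ContinuousLinearMap.inl ℝ E ℝ))
        (hh'.clm_comp contDiff_const)
    · refine hasFDerivAt_intervalIntegral_of_continuous (h := fun p s => h (p, s)) hh.continuous
        (h' := fun p s => (h' (p, s)).comp (ContinuousLinearMap.inl ℝ E ℝ))
        (hh'.continuous.clm_comp continuous_const) (fun p s => ?_) a b p
      exact (hd (p, s)).comp p (hasFDerivAt_prodMk_left p s)

theorem contDiff_integral_moving (n : ℕ) {h : (ℝ × ℝ) × ℝ → ℝ} (hh : ContDiff ℝ n h) :
    ContDiff ℝ n fun p : ℝ × ℝ => ∫ s in (0 : ℝ)..p.1, h (p, s) := by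
  -- Rescaling `s` by the upper limit makes the endpoints constant.
  have e : (fun p : ℝ × ℝ => ∫ s in (0 : ℝ)..p.1, h (p, s)) =
      fun p : ℝ × ℝ => ∫ s in (0 : ℝ)..1, p.1 * h (p, p.1 * s) := by
    funext p
    rw [intervalIntegral.integral_const_mul,
      intervalIntegral.mul_integral_comp_mul_left (f := fun s => h (p, s))]
    simp
  rw [e]
  refine contDiff_intervalIntegral n
    (h := fun q : (ℝ × ℝ) × ℝ => q.1.1 * h (q.1, q.1.1 * q.2)) ?_ 0 1
  exact (contDiff_fst.comp contDiff_fst).mul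
    (hh.comp (contDiff_fst.prodMk ((contDiff_fst.comp contDiff_fst).mul contDiff_snd)))

end ParametricIntegral

/-! ### The Klein-Gordon equation by Riemann's method. -/

section KleinGordon

/-- The Riemann function of the operator `∂ₜ² - ∂ₛ² - 4c`. -/
noncomputable def riemannKernel (c t s : ℝ) : ℝ := besselSeries 0 (c * (t ^ 2 - s ^ 2))

/-- d'Alembert's solution of the wave equation of speed `ω` with position `ρ` and velocity `0`. -/
noncomputable def waveMean (ω : ℝ) (ρ : ℝ → ℝ) (s z : ℝ) : ℝ := (ρ (z + ω * s) + ρ (z - ω * s)) / 2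

/-- The solution of `u_tt = ω² u_zz + 4c u` with position `0` and velocity `ρ`. -/
noncomputable def kleinGordon (c ω : ℝ) (ρ : ℝ → ℝ) (t z : ℝ) : ℝ :=
  ∫ s in (0 : ℝ)..t, riemannKernel c t s * waveMean ω ρ s z

/-- The time derivative of `kleinGordon`. -/
noncomputable def kleinGordonDt (c ω : ℝ) (ρ : ℝ → ℝ) (t z : ℝ) : ℝ :=
  waveMean ω ρ t z +
    ∫ s in (0 : ℝ)..t, 2 * c * t * besselSeries 1 (c * (t ^ 2 - s ^ 2)) * waveMean ω ρ s z

theorem riemannKernel_self (c t : ℝ) : riemannKernel c t t = 1 := by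
  simp [riemannKernel, besselSeries_zero_zero]

theorem besselSeries_one_zero : besselSeries 1 0 = 1 := by
  have := besselSeries_recurrence 0 0
  simpa [besselSeries_zero_zero] using this.symm

theorem continuous_besselSeries (k : ℕ) : Continuous (besselSeries k) :=
  (contDiff_besselSeries 0 k).continuous

theorem hasDerivAt_besselSeries_left (k : ℕ) (c t s : ℝ) :
    HasDerivAt (fun r => besselSeries k (c * (r ^ 2 - s ^ 2)))
      (2 * c * t * besselSeries (k + 1) (c * (t ^ 2 - s ^ 2))) t := by
  have h : HasDerivAt (fun r : ℝ => c * (r ^ 2 - s ^ 2)) (2 * c * t) t := by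
    have := ((hasDerivAt_pow 2 t).sub_const (s ^ 2)).const_mul c
    convert! this using 1
    norm_num
    ring
  have := (hasDerivAt_besselSeries k (c * (t ^ 2 - s ^ 2))).comp t h
  convert! this using 1
  ring

theorem hasDerivAt_besselSeries_right (k : ℕ) (c t s : ℝ) :
    HasDerivAt (fun r => besselSeries k (c * (t ^ 2 - r ^ 2)))
      (-(2 * c * s) * besselSeries (k + 1) (c * (t ^ 2 - s ^ 2))) s := by
  have h : HasDerivAt (fun r : ℝ => c * (t ^ 2 - r ^ 2)) (-(2 * c * s)) s := by
    have := ((hasDerivAt_pow 2 s).const_sub (t ^ 2)).const_mul c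
    convert! this using 1
    norm_num
    ring
  have := (hasDerivAt_besselSeries k (c * (t ^ 2 - s ^ 2))).comp s h
  convert! this using 1
  ring

variable {c ω : ℝ} {ρ : ℝ → ℝ}

theorem continuous_waveMean (hρ : Continuous ρ) :
    Continuous fun p : ℝ × ℝ => waveMean ω ρ p.1 p.2 := by
  unfold waveMean
  fun_prop

theorem hasDerivAt_waveMean_left {ρ' : ℝ → ℝ} (hρ : ∀ u, HasDerivAt ρ (ρ' u) u) (s z : ℝ) :
    HasDerivAt (fun r => waveMean ω ρ r z)
      (ω * ((ρ' (z + ω * s) - ρ' (z - ω * s)) / 2)) s := by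
  have h1 : HasDerivAt (fun r : ℝ => z + ω * r) ω s := by
    simpa using ((hasDerivAt_id s).const_mul ω).const_add z
  have h2 : HasDerivAt (fun r : ℝ => z - ω * r) (-ω) s := by
    simpa using ((hasDerivAt_id s).const_mul ω).const_sub z
  have := (((hρ _).comp s h1).add ((hρ _).comp s h2)).div_const 2
  convert! this using 1
  ring

theorem hasDerivAt_waveMean_left_deriv {ρ' ρ'' : ℝ → ℝ} (hρ' : ∀ u, HasDerivAt ρ' (ρ'' u) u)
    (s z : ℝ) :
    HasDerivAt (fun r => ω * ((ρ' (z + ω * r) - ρ' (z - ω * r)) / 2))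
      (ω ^ 2 * waveMean ω ρ'' s z) s := by
  have h1 : HasDerivAt (fun r : ℝ => z + ω * r) ω s := by
    simpa using ((hasDerivAt_id s).const_mul ω).const_add z
  have h2 : HasDerivAt (fun r : ℝ => z - ω * r) (-ω) s := by
    simpa using ((hasDerivAt_id s).const_mul ω).const_sub z
  have := ((((hρ' _).comp s h1).sub ((hρ' _).comp s h2)).div_const 2).const_mul ω
  convert! this using 1
  unfold waveMean
  ring

theorem hasDerivAt_waveMean_right {ρ' : ℝ → ℝ} (hρ : ∀ u, HasDerivAt ρ (ρ' u) u) (s z : ℝ) :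
    HasDerivAt (fun y => waveMean ω ρ s y) (waveMean ω ρ' s z) z := by
  have h1 : HasDerivAt (fun y : ℝ => y + ω * s) 1 z := (hasDerivAt_id z).add_const _
  have h2 : HasDerivAt (fun y : ℝ => y - ω * s) 1 z := (hasDerivAt_id z).sub_const _
  have := (((hρ _).comp z h1).add ((hρ _).comp z h2)).div_const 2
  convert! this using 1
  unfold waveMean
  ring

theorem contDiff_kleinGordon {n : ℕ} (hρ : ContDiff ℝ n ρ) :
    ContDiff ℝ n fun p : ℝ × ℝ => kleinGordon c ω ρ p.1 p.2 := by
  have hb : ContDiff ℝ n (besselSeries 0) := contDiff_besselSeries n 0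
  refine contDiff_integral_moving n
    (h := fun q => riemannKernel c q.1.1 q.2 * waveMean ω ρ q.2 q.1.2) ?_
  unfold riemannKernel waveMean
  fun_prop

theorem hasDerivAt_kleinGordon_right {ρ' : ℝ → ℝ} (hρ : ∀ u, HasDerivAt ρ (ρ' u) u)
    (hρ' : Continuous ρ') (t z : ℝ) :
    HasDerivAt (fun y => kleinGordon c ω ρ t y) (kleinGordon c ω ρ' t z) z := by
  have hc : Continuous ρ := continuous_iff_continuousAt.2 fun u => (hρ u).continuousAt
  have hb := continuous_besselSeries 0
  have hw : Continuous fun p : ℝ × ℝ => waveMean ω ρ p.2 p.1 :=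
    (continuous_waveMean hc).comp continuous_swap
  have hw' : Continuous fun p : ℝ × ℝ => waveMean ω ρ' p.2 p.1 :=
    (continuous_waveMean hρ').comp continuous_swap
  have hk : Continuous fun p : ℝ × ℝ => riemannKernel c t p.2 := by
    unfold riemannKernel
    fun_prop
  exact hasDerivAt_intervalIntegral_of_continuous
    (h := fun y s => riemannKernel c t s * waveMean ω ρ s y)
    (h' := fun y s => riemannKernel c t s * waveMean ω ρ' s y) (hk.mul hw) (hk.mul hw')
    (fun y s => (hasDerivAt_waveMean_right hρ s y).const_mul _) 0 t z

theorem hasDerivAt_kleinGordon_left (hρ : Continuous ρ) (t z : ℝ) :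
    HasDerivAt (fun r => kleinGordon c ω ρ r z) (kleinGordonDt c ω ρ t z) t := by
  have hb := continuous_besselSeries 0
  have hb' := continuous_besselSeries 1
  have hw : Continuous fun p : ℝ × ℝ => waveMean ω ρ p.2 z :=
    (continuous_waveMean hρ).comp (by fun_prop : Continuous fun p : ℝ × ℝ => (p.2, z))
  have hk : Continuous fun p : ℝ × ℝ => riemannKernel c p.1 p.2 := by
    unfold riemannKernel
    fun_prop
  have hk' : Continuous fun p : ℝ × ℝ =>
      2 * c * p.1 * besselSeries 1 (c * (p.1 ^ 2 - p.2 ^ 2)) := by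
    fun_prop
  have := hasDerivAt_integral_leibniz (h := fun r s => riemannKernel c r s * waveMean ω ρ s z)
    (h' := fun r s => 2 * c * r * besselSeries 1 (c * (r ^ 2 - s ^ 2)) * waveMean ω ρ s z)
    (hk.mul hw) (hk'.mul hw)
    (fun r s => (hasDerivAt_besselSeries_left 0 c r s).mul_const _) t
  rw [riemannKernel_self, one_mul] at this
  exact this

/-- Write `k` for the Riemann kernel and `W` for the wave mean. Then `k_tt - k_ss = 4ck` and `W_ss =
ω² ρ''`-mean, so moving two `s`-derivatives from `k` to `W` produces the right-hand side. The
boundary terms cancel those of the Leibniz rule. -/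
theorem hasDerivAt_kleinGordonDt_left {ρ' ρ'' : ℝ → ℝ} (hρ : ∀ u, HasDerivAt ρ (ρ' u) u)
    (hρ' : ∀ u, HasDerivAt ρ' (ρ'' u) u) (hρ'' : Continuous ρ'') (t z : ℝ) :
    HasDerivAt (fun r => kleinGordonDt c ω ρ r z)
      (ω ^ 2 * kleinGordon c ω ρ'' t z + 4 * c * kleinGordon c ω ρ t z) t := by
  have hc : Continuous ρ := continuous_iff_continuousAt.2 fun u => (hρ u).continuousAt
  have hc' : Continuous ρ' := continuous_iff_continuousAt.2 fun u => (hρ' u).continuousAt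
  have hb := continuous_besselSeries 0
  have hb1 := continuous_besselSeries 1
  have hb2 := continuous_besselSeries 2
  have hw1 : Continuous fun s => waveMean ω ρ s z :=
    (continuous_waveMean hc).comp (by fun_prop : Continuous fun s : ℝ => (s, z))
  have hw1'' : Continuous fun s => waveMean ω ρ'' s z :=
    (continuous_waveMean hρ'').comp (by fun_prop : Continuous fun s : ℝ => (s, z))
  have hw : Continuous fun p : ℝ × ℝ => waveMean ω ρ p.2 z := hw1.comp continuous_snd
  have hk : Continuous fun p : ℝ × ℝ =>
      2 * c * p.1 * besselSeries 1 (c * (p.1 ^ 2 - p.2 ^ 2)) := by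
    fun_prop
  have hk' : Continuous fun p : ℝ × ℝ =>
      2 * c * besselSeries 1 (c * (p.1 ^ 2 - p.2 ^ 2)) +
        2 * c * p.1 * (2 * c * p.1 * besselSeries 2 (c * (p.1 ^ 2 - p.2 ^ 2))) := by
    fun_prop
  have h1 := hasDerivAt_integral_leibniz
    (h := fun r s => 2 * c * r * besselSeries 1 (c * (r ^ 2 - s ^ 2)) * waveMean ω ρ s z)
    (h' := fun r s => (2 * c * besselSeries 1 (c * (r ^ 2 - s ^ 2)) +
        2 * c * r * (2 * c * r * besselSeries 2 (c * (r ^ 2 - s ^ 2)))) * waveMean ω ρ s z)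
    (hk.mul hw) (hk'.mul hw)
    (fun r s => by
      have h2 : HasDerivAt (fun r : ℝ => 2 * c * r) (2 * c) r := by
        simpa using (hasDerivAt_id r).const_mul (2 * c)
      exact (h2.mul (hasDerivAt_besselSeries_left 1 c r s)).mul_const _) t
  refine ((hasDerivAt_waveMean_left hρ t z).add h1).congr_deriv ?_
  -- Lagrange's identity: the integrand is the `s`-derivative of `k_s W - k W_s`, which vanishes at
  -- `s = 0`.
  have hparts : ∫ s in (0 : ℝ)..t, ((-(2 * c) * besselSeries 1 (c * (t ^ 2 - s ^ 2)) +
        -(2 * c * s) * (-(2 * c * s) * besselSeries 2 (c * (t ^ 2 - s ^ 2)))) * waveMean ω ρ s z -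
        riemannKernel c t s * (ω ^ 2 * waveMean ω ρ'' s z)) =
      -(2 * c * t) * waveMean ω ρ t z - ω * ((ρ' (z + ω * t) - ρ' (z - ω * t)) / 2) := by
    have hd : ∀ s, HasDerivAt (fun s => -(2 * c * s) * besselSeries 1 (c * (t ^ 2 - s ^ 2)) *
        waveMean ω ρ s z -
          riemannKernel c t s * (ω * ((ρ' (z + ω * s) - ρ' (z - ω * s)) / 2)))
        ((-(2 * c) * besselSeries 1 (c * (t ^ 2 - s ^ 2)) +
        -(2 * c * s) * (-(2 * c * s) * besselSeries 2 (c * (t ^ 2 - s ^ 2)))) * waveMean ω ρ s z -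
        riemannKernel c t s * (ω ^ 2 * waveMean ω ρ'' s z)) s := by
      intro s
      have h2 : HasDerivAt (fun r : ℝ => -(2 * c * r)) (-(2 * c)) s := by
        simpa using ((hasDerivAt_id s).const_mul (2 * c)).fun_neg
      have h3 := (h2.mul (hasDerivAt_besselSeries_right 1 c t s)).mul
        (hasDerivAt_waveMean_left (ω := ω) hρ s z)
      have h4 := (hasDerivAt_besselSeries_right 0 c t s).mul
        (hasDerivAt_waveMean_left_deriv (ω := ω) hρ' s z)
      refine (h3.sub h4).congr_deriv ?_
      simp only [riemannKernel, Pi.mul_apply]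
      ring
    rw [intervalIntegral.integral_eq_sub_of_hasDerivAt (fun s _ => hd s)]
    · rw [riemannKernel_self]
      simp [besselSeries_one_zero]
    · refine Continuous.intervalIntegrable ?_ _ _
      unfold riemannKernel
      fun_prop
  -- The Bessel recurrence at `w = c(t² - s²)` is exactly `k_tt - k_ss = 4ck`.
  have hsum : ∫ s in (0 : ℝ)..t, (2 * c * besselSeries 1 (c * (t ^ 2 - s ^ 2)) +
        2 * c * t * (2 * c * t * besselSeries 2 (c * (t ^ 2 - s ^ 2)))) * waveMean ω ρ s z =
      (-(2 * c * t) * waveMean ω ρ t z - ω * ((ρ' (z + ω * t) - ρ' (z - ω * t)) / 2)) +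
      (ω ^ 2 * kleinGordon c ω ρ'' t z + 4 * c * kleinGordon c ω ρ t z) := by
    rw [← hparts, kleinGordon, kleinGordon, ← intervalIntegral.integral_const_mul,
      ← intervalIntegral.integral_const_mul, ← intervalIntegral.integral_add,
      ← intervalIntegral.integral_add]
    · refine intervalIntegral.integral_congr fun s _ => ?_
      have hrec := besselSeries_recurrence 0 (c * (t ^ 2 - s ^ 2))
      simp only [riemannKernel]
      rw [hrec]
      push_cast
      ring
    all_goals
      refine Continuous.intervalIntegrable ?_ _ _
      unfold riemannKernel
      fun_prop
  rw [hsum]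
  have := besselSeries_one_zero
  simp only [sub_self, mul_zero, this]
  ring

theorem kleinGordon_zero (z : ℝ) : kleinGordon c ω ρ 0 z = 0 := by simp [kleinGordon]

theorem kleinGordonDt_zero (z : ℝ) : kleinGordonDt c ω ρ 0 z = ρ z := by
  simp [kleinGordonDt, waveMean]

theorem kleinGordon_add_period {L : ℝ} (hρ : Function.Periodic ρ L) (t z : ℝ) :
    kleinGordon c ω ρ t (z + L) = kleinGordon c ω ρ t z := by
  have h : ∀ s, waveMean ω ρ s (z + L) = waveMean ω ρ s z := by
    intro s
    unfold waveMean
    rw [show z + L + ω * s = z + ω * s + L by ring, show z + L - ω * s = z - ω * s + L by ring,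
      hρ, hρ]
  simp [kleinGordon, h]

end KleinGordon

/-! ### Construction of the damped forced wave. -/

section DampedWave

theorem contDiff_primitive {n : ℕ} {h : ℝ → ℝ} (hh : ContDiff ℝ n h) :
    ContDiff ℝ (n + 1) fun t => ∫ s in (0 : ℝ)..t, h s := by
  have hd : ∀ t, HasDerivAt (fun t => ∫ s in (0 : ℝ)..t, h s) (h t) t :=
    fun t => (hh.continuous.integral_hasStrictDerivAt 0 t).hasDerivAt
  refine contDiff_succ_iff_deriv.2 ⟨fun t => (hd t).differentiableAt, by simp, ?_⟩
  rwa [funext fun t => (hd t).deriv]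

theorem primitive_add_period {h : ℝ → ℝ} {L : ℝ} (hc : Continuous h)
    (hp : Function.Periodic h L) (z : ℝ) :
    ∫ u in (0 : ℝ)..(z + L), h u = (∫ u in (0 : ℝ)..z, h u) + ∫ u in (0 : ℝ)..L, h u := by
  rw [← intervalIntegral.integral_add_adjacent_intervals (hc.intervalIntegrable 0 z)
    (hc.intervalIntegrable z (z + L)), hp.intervalIntegral_add_eq z 0, zero_add]

/-- `G` is a `C²` solution of `G_tt = ω² G_zz - α G_t + f(t)` with the indicated derivatives. -/
structure IsDampedWave (ω α : ℝ) (f : ℝ → ℝ) (G Gt Gtt Gz Gzz : ℝ → ℝ → ℝ) : Prop where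
  contDiff : ContDiff ℝ 2 fun p : ℝ × ℝ => G p.1 p.2
  continuous_zz : Continuous fun p : ℝ × ℝ => Gzz p.1 p.2
  hasDerivAt_t : ∀ t z, HasDerivAt (fun s => G s z) (Gt t z) t
  hasDerivAt_tt : ∀ t z, HasDerivAt (fun s => Gt s z) (Gtt t z) t
  hasDerivAt_z : ∀ t z, HasDerivAt (fun y => G t y) (Gz t z) z
  hasDerivAt_zz : ∀ t z, HasDerivAt (fun y => Gz t y) (Gzz t z) z
  equation : ∀ t z, Gtt t z = ω ^ 2 * Gzz t z - α * Gt t z + f t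

theorem ContDiff.hasDerivAt_deriv {n : ℕ} {h : ℝ → ℝ} (hh : ContDiff ℝ (n + 1) h) (u : ℝ) :
    HasDerivAt h (deriv h u) u :=
  ((contDiff_succ_iff_deriv.1 hh).1 u).hasDerivAt

theorem contDiff_deriv_of_succ {n : ℕ} {h : ℝ → ℝ} (hh : ContDiff ℝ (n + 1) h) :
    ContDiff ℝ n (deriv h) :=
  (contDiff_succ_iff_deriv.1 hh).2.2

-- The velocity datum `χ` is handled by `kleinGordon` directly. For the position datum, `u - φ` has
-- zero data and the time-independent source `ρ = ω²φ'' + 4cφ`, so Duhamel's formula gives the time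
-- integral of `kleinGordon` for `ρ`. This is why `φ` has two more derivatives than `χ`.
set_option maxHeartbeats 1000000 in
theorem exists_kleinGordon (c ω L : ℝ) {φ χ : ℝ → ℝ} (hφ : ContDiff ℝ 4 φ) (hχ : ContDiff ℝ 2 χ)
    (hφL : Function.Periodic φ L) (hχL : Function.Periodic χ L) :
    ∃ u ut utt uz uzz : ℝ → ℝ → ℝ,
      ContDiff ℝ 2 (fun p : ℝ × ℝ => u p.1 p.2) ∧
      Continuous (fun p : ℝ × ℝ => uzz p.1 p.2) ∧
      (∀ t z, HasDerivAt (fun s => u s z) (ut t z) t) ∧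
      (∀ t z, HasDerivAt (fun s => ut s z) (utt t z) t) ∧
      (∀ t z, HasDerivAt (fun y => u t y) (uz t z) z) ∧
      (∀ t z, HasDerivAt (fun y => uz t y) (uzz t z) z) ∧
      (∀ t z, utt t z = ω ^ 2 * uzz t z + 4 * c * u t z) ∧
      (∀ z, u 0 z = φ z) ∧ (∀ z, ut 0 z = χ z) ∧
      (∀ t z, u t (z + L) = u t z) := by
  have hφ1 : ContDiff ℝ (3 : ℕ) (deriv φ) := contDiff_deriv_of_succ (by exact_mod_cast hφ)
  have hφ2 : ContDiff ℝ (2 : ℕ) (deriv (deriv φ)) := contDiff_deriv_of_succ (by exact_mod_cast hφ1)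
  have hφd : ∀ z, HasDerivAt φ (deriv φ z) z :=
    ContDiff.hasDerivAt_deriv (n := 3) (by exact_mod_cast hφ)
  have hφd1 : ∀ z, HasDerivAt (deriv φ) (deriv (deriv φ) z) z :=
    ContDiff.hasDerivAt_deriv (n := 2) (by exact_mod_cast hφ1)
  set ρ : ℝ → ℝ := fun z => ω ^ 2 * deriv (deriv φ) z + 4 * c * φ z with hρdef
  have hρ : ContDiff ℝ (2 : ℕ) ρ := by
    have : ContDiff ℝ (2 : ℕ) φ := hφ.of_le (by norm_num)
    exact (contDiff_const.mul hφ2).add (contDiff_const.mul this)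
  have hderivL : ∀ {h : ℝ → ℝ}, Function.Periodic h L → Function.Periodic (deriv h) L := by
    intro h hh z
    rw [← deriv_comp_add_const, show (fun y => h (y + L)) = h from funext hh]
  have hρL : Function.Periodic ρ L := by
    intro z
    simp only [hρdef]
    rw [hderivL (hderivL hφL) z, hφL z]
  have key : ∀ {h : ℝ → ℝ}, ContDiff ℝ (2 : ℕ) h → Continuous h ∧ Continuous (deriv h) ∧
      Continuous (deriv (deriv h)) ∧ (∀ z, HasDerivAt h (deriv h z) z) ∧
      (∀ z, HasDerivAt (deriv h) (deriv (deriv h) z) z) := by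
    intro h hh
    have h1 : ContDiff ℝ (1 : ℕ) (deriv h) := contDiff_deriv_of_succ (by exact_mod_cast hh)
    have h2 : ContDiff ℝ (0 : ℕ) (deriv (deriv h)) :=
      contDiff_deriv_of_succ (by exact_mod_cast h1)
    exact ⟨hh.continuous, h1.continuous, h2.continuous,
      ContDiff.hasDerivAt_deriv (n := 1) (by exact_mod_cast hh),
      ContDiff.hasDerivAt_deriv (n := 0) (by exact_mod_cast h1)⟩
  obtain ⟨ρc, ρ1c, ρ2c, ρd, ρd1⟩ := key hρ
  obtain ⟨χc, χ1c, χ2c, χd, χd1⟩ := key (h := χ) (by exact_mod_cast hχ)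
  have hKc : ∀ {h : ℝ → ℝ}, Continuous h →
      Continuous fun p : ℝ × ℝ => kleinGordon c ω h p.1 p.2 := fun hh =>
    (contDiff_kleinGordon (n := 0) (contDiff_zero.2 hh)).continuous
  have hKt : ∀ {h : ℝ → ℝ}, Continuous h → ∀ z, Continuous fun t => kleinGordon c ω h t z :=
    fun hh z => (hKc hh).comp (by fun_prop : Continuous fun t : ℝ => (t, z))
  have hKs : ∀ {h : ℝ → ℝ}, Continuous h →
      Continuous fun p : ℝ × ℝ => kleinGordon c ω h p.2 p.1 := fun hh =>
    (hKc hh).comp continuous_swap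
  refine ⟨fun t z => φ z + (∫ s in (0 : ℝ)..t, kleinGordon c ω ρ s z) + kleinGordon c ω χ t z,
    fun t z => kleinGordon c ω ρ t z + kleinGordonDt c ω χ t z,
    fun t z => kleinGordonDt c ω ρ t z +
      (ω ^ 2 * kleinGordon c ω (deriv (deriv χ)) t z + 4 * c * kleinGordon c ω χ t z),
    fun t z => deriv φ z + (∫ s in (0 : ℝ)..t, kleinGordon c ω (deriv ρ) s z) +
      kleinGordon c ω (deriv χ) t z,
    fun t z => deriv (deriv φ) z + (∫ s in (0 : ℝ)..t, kleinGordon c ω (deriv (deriv ρ)) s z) +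
      kleinGordon c ω (deriv (deriv χ)) t z, ?_, ?_, ?_, ?_, ?_, ?_, ?_, ?_, ?_, ?_⟩
  · refine ContDiff.add (ContDiff.add ?_ ?_) ?_
    · exact (hφ.of_le (by norm_num)).comp contDiff_snd
    · refine contDiff_integral_moving 2 (h := fun q => kleinGordon c ω ρ q.2 q.1.2) ?_
      exact (contDiff_kleinGordon (c := c) (ω := ω) hρ).comp
        (contDiff_snd.prodMk (contDiff_snd.comp contDiff_fst))
    · exact contDiff_kleinGordon (n := 2) (by exact_mod_cast hχ)
  · refine Continuous.add (Continuous.add ?_ ?_) ?_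
    · exact hφ2.continuous.comp continuous_snd
    · exact continuous_intervalIntegral_uncurry
        (h := fun z s => kleinGordon c ω (deriv (deriv ρ)) s z) (hKs ρ2c)
    · exact hKc χ2c
  · intro t z
    exact ((((hKt ρc z).integral_hasStrictDerivAt 0 t).hasDerivAt).const_add (φ z)).add
      (hasDerivAt_kleinGordon_left χc t z)
  · intro t z
    exact (hasDerivAt_kleinGordon_left ρc t z).add
      (hasDerivAt_kleinGordonDt_left χd χd1 χ2c t z)
  · intro t z
    exact ((hφd z).add (hasDerivAt_intervalIntegral_of_continuous
      (h := fun y s => kleinGordon c ω ρ s y) (h' := fun y s => kleinGordon c ω (deriv ρ) s y)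
      (hKs ρc) (hKs ρ1c) (fun y s => hasDerivAt_kleinGordon_right ρd ρ1c s y) 0 t z)).add
      (hasDerivAt_kleinGordon_right χd χ1c t z)
  · intro t z
    exact ((hφd1 z).add (hasDerivAt_intervalIntegral_of_continuous
      (h := fun y s => kleinGordon c ω (deriv ρ) s y)
      (h' := fun y s => kleinGordon c ω (deriv (deriv ρ)) s y)
      (hKs ρ1c) (hKs ρ2c) (fun y s => hasDerivAt_kleinGordon_right ρd1 ρ2c s y) 0 t z)).add
      (hasDerivAt_kleinGordon_right χd1 χ2c t z)
  · intro t z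
    -- The integrand is the second time derivative of `kleinGordon` for `ρ`, so the integral
    -- telescopes; the term `-ρ` cancels against the contribution of `φ`.
    have hint : ∫ s in (0 : ℝ)..t, (ω ^ 2 * kleinGordon c ω (deriv (deriv ρ)) s z +
        4 * c * kleinGordon c ω ρ s z) = kleinGordonDt c ω ρ t z - ρ z := by
      rw [intervalIntegral.integral_eq_sub_of_hasDerivAt
        (fun s _ => hasDerivAt_kleinGordonDt_left ρd ρd1 ρ2c s z), kleinGordonDt_zero]
      exact (((hKt ρ2c z).const_mul _).add ((hKt ρc z).const_mul _)).intervalIntegrable _ _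
    rw [intervalIntegral.integral_add (((hKt ρ2c z).const_mul _).intervalIntegrable _ _)
      (((hKt ρc z).const_mul _).intervalIntegrable _ _), intervalIntegral.integral_const_mul,
      intervalIntegral.integral_const_mul] at hint
    simp only [hρdef] at hint ⊢
    linear_combination -hint
  · intro z
    simp [kleinGordon_zero]
  · intro z
    simp [kleinGordon_zero, kleinGordonDt_zero]
  · intro t z
    simp only [kleinGordon_add_period hρL, kleinGordon_add_period hχL, hφL z]

/-- The spatially constant response to `f` from rest, obtained with the integrating factor
`exp(αt)`. -/
theorem exists_forcing (α : ℝ) {f : ℝ → ℝ} (hf : ContDiff ℝ 2 f) :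
    ∃ g g' : ℝ → ℝ, ContDiff ℝ 2 g ∧ (∀ t, HasDerivAt g (g' t) t) ∧
      (∀ t, HasDerivAt g' (-α * g' t + f t) t) ∧ g 0 = 0 ∧ g' 0 = 0 := by
  set g' : ℝ → ℝ := fun t => Real.exp (-α * t) * ∫ s in (0 : ℝ)..t, Real.exp (α * s) * f s with hg'
  have hef : Continuous fun s => Real.exp (α * s) * f s := by
    have := hf.continuous
    fun_prop
  have hd' : ∀ t, HasDerivAt g' (-α * g' t + f t) t := by
    intro t
    have h1 : HasDerivAt (fun t => Real.exp (-α * t)) (Real.exp (-α * t) * -α) t := by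
      simpa using ((hasDerivAt_id t).const_mul (-α)).exp
    refine (h1.mul (hef.integral_hasStrictDerivAt 0 t).hasDerivAt).congr_deriv ?_
    have h2 : Real.exp (-α * t) * Real.exp (α * t) = 1 := by
      rw [← Real.exp_add]
      simp
    simp only [hg']
    linear_combination f t * h2
  have hg'c : Continuous g' := continuous_iff_continuousAt.2 fun t => (hd' t).continuousAt
  have hg'1 : ContDiff ℝ (1 : ℕ) g' := by
    refine contDiff_one_iff_deriv.2 ⟨fun t => (hd' t).differentiableAt, ?_⟩
    rw [funext fun t => (hd' t).deriv]
    exact (continuous_const.mul hg'c).add hf.continuous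
  refine ⟨fun t => ∫ s in (0 : ℝ)..t, g' s, g', ?_, ?_, hd', by simp, by simp [hg']⟩
  · exact_mod_cast contDiff_primitive hg'1
  · exact fun t => (hg'c.integral_hasStrictDerivAt 0 t).hasDerivAt

theorem exists_dampedWave {L ω α v : ℝ} {f X V : ℝ → ℝ} (hf : ContDiff ℝ 2 f)
    (hXV : IsProfile L X V) :
    ∃ G Gt Gtt Gz Gzz : ℝ → ℝ → ℝ, IsDampedWave ω α f G Gt Gtt Gz Gzz ∧
      (∀ z, G 0 z = ∫ u in (0 : ℝ)..z, X u) ∧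
      (∀ z, Gt 0 z = v + ∫ u in (0 : ℝ)..z, V u) ∧
      (∀ t z, G t (z + L) = G t z + L) := by
  obtain ⟨g, g', hg, hgd, hgd', hg0, hg0'⟩ := exists_forcing α hf
  have hXc := hXV.contDiff_X.continuous
  have hVc := hXV.contDiff_V.continuous
  -- Subtracting `z` makes the position periodic because `X` has mean one. In `χ`, the term `α/2 *
  -- φ` compensates the time derivative of the factor `exp(-αt/2)`.
  set φ : ℝ → ℝ := fun z => (∫ u in (0 : ℝ)..z, X u) - z with hφdef
  set χ : ℝ → ℝ := fun z => v + (∫ u in (0 : ℝ)..z, V u) + α / 2 * φ z with hχdef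
  have hφ : ContDiff ℝ 4 φ :=
    ((contDiff_primitive (n := 4) hXV.contDiff_X).of_le (by norm_num)).sub contDiff_id
  have hχ : ContDiff ℝ 2 χ :=
    (contDiff_const.add ((contDiff_primitive (n := 4) hXV.contDiff_V).of_le (by norm_num))).add
      (contDiff_const.mul (hφ.of_le (by norm_num)))
  have hφL : Function.Periodic φ L := by
    intro z
    simp only [hφdef, primitive_add_period hXc hXV.periodic_X, hXV.integral_X]
    ring
  have hχL : Function.Periodic χ L := by
    intro z
    simp only [hχdef, primitive_add_period hVc hXV.periodic_V, hXV.integral_V, hφL z]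
    ring
  -- Removing the damping leaves the zeroth-order coefficient `α²/4 = 4c`, hence `c = α²/16`.
  obtain ⟨u, ut, utt, uz, uzz, hu, huzz, dt, dtt, dz, dzz, heq, hu0, hut0, huL⟩ :=
    exists_kleinGordon (α ^ 2 / 16) ω L hφ hχ hφL hχL
  have he : ∀ t, HasDerivAt (fun t => Real.exp (-(α / 2) * t))
      (Real.exp (-(α / 2) * t) * -(α / 2)) t := fun t => by
    simpa using ((hasDerivAt_id t).const_mul (-(α / 2))).exp
  refine ⟨fun t z => g t + z + Real.exp (-(α / 2) * t) * u t z,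
    fun t z => g' t + Real.exp (-(α / 2) * t) * (ut t z - α / 2 * u t z),
    fun t z => -α * g' t + f t +
      Real.exp (-(α / 2) * t) * (utt t z - α * ut t z + α ^ 2 / 4 * u t z),
    fun t z => 1 + Real.exp (-(α / 2) * t) * uz t z,
    fun t z => Real.exp (-(α / 2) * t) * uzz t z, ⟨?_, ?_, ?_, ?_, ?_, ?_, ?_⟩, ?_, ?_, ?_⟩
  · have h1 : ContDiff ℝ 2 fun p : ℝ × ℝ => g p.1 := hg.comp contDiff_fst
    fun_prop
  · fun_prop
  · intro t z
    refine (((hgd t).add_const z).add ((he t).mul (dt t z))).congr_deriv ?_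
    ring
  · intro t z
    refine ((hgd' t).add ((he t).mul ((dtt t z).fun_sub ((dt t z).const_mul (α / 2))))).congr_deriv ?_
    ring
  · intro t z
    exact ((hasDerivAt_id z).const_add (g t)).add ((dz t z).const_mul _)
  · intro t z
    exact ((dzz t z).const_mul _).const_add 1
  · intro t z
    rw [heq]
    ring
  · intro z
    simp [hg0, hu0, hφdef]
  · intro z
    simp only [hg0', hut0, hu0, hχdef, mul_zero, Real.exp_zero]
    ring
  · intro t z
    simp only [huL]
    ring

end DampedWave

/-! ### Uniform estimates for periodic functions and difference quotients. -/

section Periodic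

theorem exists_uniform_modulus {h : ℝ → ℝ → ℝ} {L : ℝ} (hL : 0 < L)
    (hc : Continuous fun p : ℝ × ℝ => h p.1 p.2) (hp : ∀ t, Function.Periodic (h t) L)
    (T : ℝ) {ε : ℝ} (hε : 0 < ε) :
    ∃ δ > 0, ∀ t ∈ Icc 0 T, ∀ y z, |y - z| ≤ δ → |h t y - h t z| ≤ ε := by
  -- One period with a margin of 1 on each side: both points are shifted by the same multiple of
  -- `L`, and they are at most 1 apart.
  have hK : IsCompact (Icc (0 : ℝ) T ×ˢ Icc (-1) (L + 1)) := isCompact_Icc.prod isCompact_Icc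
  obtain ⟨δ, hδ, H⟩ := Metric.uniformContinuousOn_iff.1
    (hK.uniformContinuousOn_of_continuous hc.continuousOn) ε hε
  refine ⟨min (δ / 2) 1, by positivity, fun t ht y z hyz => ?_⟩
  have h1 : |y - z| ≤ δ / 2 := hyz.trans (min_le_left _ _)
  have h2 := abs_le.1 (hyz.trans (min_le_right _ _))
  set n : ℤ := ⌊z / L⌋
  have hz0 : 0 ≤ z - n * L := Int.sub_floor_div_mul_nonneg z hL
  have hz1 : z - n * L < L := Int.sub_floor_div_mul_lt z hL
  rw [← (hp t).sub_int_mul_eq n, ← (hp t).sub_int_mul_eq (x := z) n]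
  refine (H (t, y - n * L) ⟨ht, by constructor <;> linarith⟩ (t, z - n * L)
    ⟨ht, by constructor <;> linarith⟩ ?_).le
  rw [Prod.dist_eq, dist_self, Real.dist_eq, sub_sub_sub_cancel_right]
  exact max_lt hδ (by linarith)

theorem exists_integral_approx {h : ℝ → ℝ} {L : ℝ} (hL : 0 < L) (hh : ContDiff ℝ 1 h)
    (hp : Function.Periodic h L) :
    ∃ B, 0 ≤ B ∧ ∀ z s, 0 ≤ s → |(∫ u in z..(z + s), h u) - s * h z| ≤ B * s ^ 2 := by
  obtain ⟨hd, hc⟩ := contDiff_one_iff_deriv.1 hh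
  have hp' : Function.Periodic (deriv h) L := by
    intro z
    rw [← deriv_comp_add_const, show (fun y => h (y + L)) = h from funext hp]
  obtain ⟨B, hB⟩ := (hp'.isBounded_of_continuous hL.ne' hc).exists_norm_le
  have hB0 : 0 ≤ B := (norm_nonneg _).trans (hB _ ⟨0, rfl⟩)
  refine ⟨B, hB0, fun z s hs => ?_⟩
  have hsub : (∫ u in z..(z + s), h u) - s * h z = ∫ u in z..(z + s), (h u - h z) := by
    rw [intervalIntegral.integral_sub (hh.continuous.intervalIntegrable _ _)
      intervalIntegrable_const, intervalIntegral.integral_const]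
    simp
  have hbd : ∀ u ∈ uIoc z (z + s), ‖h u - h z‖ ≤ B * s := by
    intro u hu
    rw [uIoc_of_le (by linarith)] at hu
    refine (Convex.norm_image_sub_le_of_norm_deriv_le (𝕜 := ℝ) (s := univ) (fun y _ => hd y)
      (fun y _ => hB _ ⟨y, rfl⟩) convex_univ (mem_univ z) (mem_univ u)).trans ?_
    rw [Real.norm_eq_abs, abs_of_nonneg (by linarith [hu.1])]
    exact mul_le_mul_of_nonneg_left (by linarith [hu.2]) hB0
  have := intervalIntegral.norm_integral_le_of_norm_le_const hbd
  rw [hsub, ← Real.norm_eq_abs]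
  refine this.trans (le_of_eq ?_)
  rw [add_sub_cancel_left, abs_of_nonneg hs]
  ring

/-- Two integrations in the step length, starting from zero. Only the oscillation of `g''` enters,
because `G` is merely known to be `C²`. -/
theorem abs_second_difference_sub_le {g g' g'' : ℝ → ℝ} (hg : ∀ z, HasDerivAt g (g' z) z)
    (hg' : ∀ z, HasDerivAt g' (g'' z) z) {z h ε : ℝ} (hh : 0 ≤ h)
    (hε : ∀ y, |y - z| ≤ h → |g'' y - g'' z| ≤ ε) :
    |g (z + h) - 2 * g z + g (z - h) - h ^ 2 * g'' z| ≤ ε * h ^ 2 := by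
  have hp : ∀ s : ℝ, HasDerivAt (fun s => z + s) 1 s := fun s => (hasDerivAt_id s).const_add z
  have hm : ∀ s : ℝ, HasDerivAt (fun s => z - s) (-1) s := fun s => (hasDerivAt_id s).const_sub z
  have d1 : ∀ s, HasDerivAt (fun s => g (z + s) - 2 * g z + g (z - s) - s ^ 2 * g'' z)
      (g' (z + s) - g' (z - s) - 2 * s * g'' z) s := by
    intro s
    refine (((((hg _).comp s (hp s)).sub_const (2 * g z)).add ((hg _).comp s (hm s))).sub
      ((hasDerivAt_pow 2 s).mul_const _)).congr_deriv ?_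
    norm_num
    ring
  have d2 : ∀ s, HasDerivAt (fun s => g' (z + s) - g' (z - s) - 2 * s * g'' z)
      (g'' (z + s) + g'' (z - s) - 2 * g'' z) s := by
    intro s
    refine ((((hg' _).comp s (hp s)).sub ((hg' _).comp s (hm s))).sub
      (((hasDerivAt_id s).const_mul 2).mul_const _)).congr_deriv ?_
    ring
  have b1 : ∀ s ∈ Icc 0 h, ‖g' (z + s) - g' (z - s) - 2 * s * g'' z‖ ≤ 2 * ε * s := by
    refine image_norm_le_of_norm_deriv_right_le_deriv_boundary (B' := fun _ => 2 * ε)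
      (fun s _ => (d2 s).continuousAt.continuousWithinAt) (fun s _ => (d2 s).hasDerivWithinAt)
      (by simp) (fun s => by simpa using (hasDerivAt_id s).const_mul (2 * ε)) fun s hs => ?_
    have h1 := abs_le.1 (hε (z + s) (by
      rw [add_sub_cancel_left, abs_of_nonneg hs.1]; exact hs.2.le))
    have h2 := abs_le.1 (hε (z - s) (by
      rw [sub_sub_cancel_left, abs_neg, abs_of_nonneg hs.1]; exact hs.2.le))
    exact abs_le.2 ⟨by linarith, by linarith⟩
  have b0 := image_norm_le_of_norm_deriv_right_le_deriv_boundary (a := 0) (b := h)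
    (B := fun s => ε * s ^ 2) (B' := fun s => 2 * ε * s)
    (fun s _ => (d1 s).continuousAt.continuousWithinAt) (fun s _ => (d1 s).hasDerivWithinAt)
    (by simp; ring_nf)
    (fun s => ((hasDerivAt_pow 2 s).const_mul ε).congr_deriv (by norm_num; ring))
    (fun s hs => b1 s ⟨hs.1, hs.2.le⟩)
  exact b0 ⟨hh, le_rfl⟩

end Periodic

/-! ### Energy method and discrete Sobolev inequality. -/

section Energy

theorem sum_periodic_sub_eq_zero {N : ℕ} {b : ℤ → ℝ} (hb : b N = b 0) :
    ∑ k ∈ Finset.range N, (b (k + 1) - b k) = 0 := by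
  have := Finset.sum_range_sub (fun k : ℕ => b k) N
  push_cast at this
  rw [this, hb, sub_self]

/-- The energy of a displacement field `e` with velocities `w`. -/
noncomputable def chainEnergy (N : ℕ) (Ω : ℝ) (e w : ℤ → ℝ) : ℝ :=
  ∑ k ∈ Finset.range N, (e k ^ 2 + w k ^ 2 + Ω ^ 2 * (e (k + 1) - e k) ^ 2)

theorem chainEnergy_le {N : ℕ} {Ω α r T : ℝ} (hα : 0 ≤ α) {e w R : ℤ → ℝ → ℝ}
    (he : ∀ k t, 0 ≤ t → HasDerivWithinAt (e k) (w k t) (Ici 0) t)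
    (hw : ∀ k t, 0 ≤ t → HasDerivWithinAt (w k)
      (Ω ^ 2 * (e (k + 1) t - 2 * e k t + e (k - 1) t) - α * w k t + R k t) (Ici 0) t)
    (hep : ∀ k t, 0 ≤ t → e (k + N) t = e k t) (hwp : ∀ k t, 0 ≤ t → w (k + N) t = w k t)
    (hR : ∀ k, ∀ t ∈ Icc 0 T, |R k t| ≤ r) {t : ℝ} (ht : t ∈ Icc 0 T) :
    chainEnergy N Ω (fun k => e k t) (fun k => w k t) ≤
      Real.exp (2 * t) * (chainEnergy N Ω (fun k => e k 0) (fun k => w k 0) + N * r ^ 2) := by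
  set E : ℝ → ℝ := fun t => chainEnergy N Ω (fun k => e k t) (fun k => w k t) with hE
  have hd : ∀ t, 0 ≤ t → HasDerivWithinAt E (∑ k ∈ Finset.range N,
      (2 * e k t * w k t + 2 * w k t * (Ω ^ 2 * (e (k + 1) t - 2 * e k t + e (k - 1) t) -
        α * w k t + R k t) + Ω ^ 2 * (2 * (e (k + 1) t - e k t) * (w (k + 1) t - w k t))))
      (Ici 0) t := by
    intro t ht
    refine HasDerivWithinAt.fun_sum fun k _ => ?_
    have h1 := (he k t ht).pow 2
    have h2 := (hw k t ht).pow 2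
    have h3 := (((he (k + 1) t ht).sub (he k t ht)).pow 2).const_mul (Ω ^ 2)
    refine ((h1.add h2).add h3).congr_deriv ?_
    simp
  have hbound : ∀ t ∈ Icc 0 T, (∑ k ∈ Finset.range N,
      (2 * e k t * w k t + 2 * w k t * (Ω ^ 2 * (e (k + 1) t - 2 * e k t + e (k - 1) t) -
        α * w k t + R k t) + Ω ^ 2 * (2 * (e (k + 1) t - e k t) * (w (k + 1) t - w k t)))) ≤
      2 * E t + N * r ^ 2 := by
    intro t ht
    -- Summation by parts: the elastic work and the change of elastic energy add up to differences
    -- of this `b`, which cancel over a period.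
    have hz := sum_periodic_sub_eq_zero (N := N)
      (b := fun k => 2 * Ω ^ 2 * (w k t * (e k t - e (k - 1) t))) (by
        have h1 := hep 0 t ht.1
        have h2 := hwp 0 t ht.1
        have h3 := hep (-1) t ht.1
        rw [zero_add] at h1 h2
        rw [neg_add_eq_sub] at h3
        simp only [h1, h2, h3, zero_sub])
    have hN : (N : ℝ) * r ^ 2 = ∑ k ∈ Finset.range N, r ^ 2 := by simp
    have hEt : E t = ∑ k ∈ Finset.range N,
        (e k t ^ 2 + w k t ^ 2 + Ω ^ 2 * (e (k + 1) t - e k t) ^ 2) := rfl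
    rw [← sub_zero (∑ k ∈ Finset.range N, _), ← hz, ← Finset.sum_sub_distrib, hN, hEt,
      Finset.mul_sum, ← Finset.sum_add_distrib]
    refine Finset.sum_le_sum fun k _ => ?_
    have hr : R k t ^ 2 ≤ r ^ 2 := sq_le_sq' (by linarith [(abs_le.1 (hR k t ht)).1])
      (abs_le.1 (hR k t ht)).2
    have h4 := mul_nonneg hα (sq_nonneg (w k t))
    have h5 := mul_nonneg (sq_nonneg Ω) (sq_nonneg (e (k + 1) t - e k t))
    simp only [add_sub_cancel_right]
    -- What remains is `2ew - 2αw² + 2wR`, at most `e² + 2w² + R²`.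
    nlinarith [sq_nonneg (e k t - w k t), sq_nonneg (w k t - R k t), sq_nonneg (e k t)]
  have hexp : ∀ t, HasDerivAt (fun t => Real.exp (-2 * t)) (Real.exp (-2 * t) * -2) t := fun t => by
    simpa using ((hasDerivAt_id t).const_mul (-2 : ℝ)).exp
  -- Gronwall's inequality with integrating factor `exp(-2t)`.
  have hanti : AntitoneOn (fun t => Real.exp (-2 * t) * (E t + N * r ^ 2)) (Icc 0 T) := by
    have hdH := fun t (ht : 0 ≤ t) =>
      (hexp t).hasDerivWithinAt.mul ((hd t ht).add_const (N * r ^ 2))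
    refine antitoneOn_of_hasDerivWithinAt_nonpos (convex_Icc 0 T)
      (fun s hs => (hdH s hs.1).continuousWithinAt.mono Icc_subset_Ici_self)
      (fun s hs => (hdH s (interior_subset hs).1).mono
        (interior_subset.trans Icc_subset_Ici_self)) fun s hs => ?_
    have h1 := hbound s (interior_subset hs)
    have h2 : (0 : ℝ) ≤ N * r ^ 2 := by positivity
    have h3 := Real.exp_pos (-2 * s)
    nlinarith
  have hT : (0 : ℝ) ∈ Icc 0 T := ⟨le_rfl, ht.1.trans ht.2⟩
  have h := hanti hT ht ht.1
  simp only [mul_zero, Real.exp_zero, one_mul] at h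
  have h2 : (0 : ℝ) ≤ N * r ^ 2 := by positivity
  calc E t ≤ E t + N * r ^ 2 := by linarith
    _ = Real.exp (2 * t) * (Real.exp (-2 * t) * (E t + N * r ^ 2)) := by
      rw [← mul_assoc, ← Real.exp_add]
      simp
    _ ≤ _ := mul_le_mul_of_nonneg_left h (Real.exp_pos _).le

/-- Some `|e m|` is at most the quadratic mean `η`, and the total variation over a period is at most
`η/ω₀` by Cauchy-Schwarz. The powers of `N` cancel because the stiffness is `(ω₀N)²`. -/
theorem abs_le_of_chainEnergy_le {N : ℕ} (hN : 0 < N) {ω₀ η : ℝ} (hω : 0 < ω₀) (hη : 0 ≤ η)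
    {e w : ℤ → ℝ} (hep : ∀ k, e (k + N) = e k)
    (hE : chainEnergy N (ω₀ * N) e w ≤ N * η ^ 2) (k : ℤ) : |e k| ≤ η * (1 + 1 / ω₀) := by
  have hN' : (0 : ℝ) < N := by exact_mod_cast hN
  have hle1 : ∑ k ∈ Finset.range N, e k ^ 2 ≤ N * η ^ 2 :=
    (Finset.sum_le_sum fun k _ => by
      nlinarith [sq_nonneg (w k), sq_nonneg ((ω₀ * N) * (e (k + 1) - e k))]).trans hE
  have hle2 : ∑ k ∈ Finset.range N, (ω₀ * N) ^ 2 * (e (k + 1) - e k) ^ 2 ≤ N * η ^ 2 :=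
    (Finset.sum_le_sum fun k _ => by nlinarith [sq_nonneg (w k), sq_nonneg (e k)]).trans hE
  set S := ∑ k ∈ Finset.range N, |e (k + 1) - e k| with hS
  have hS2 : S ^ 2 ≤ (η / ω₀) ^ 2 := by
    have h1 := sq_sum_le_card_mul_sum_sq (s := Finset.range N) (f := fun k : ℕ => |e (k + 1) - e k|)
    simp only [sq_abs, Finset.card_range] at h1
    rw [← Finset.mul_sum] at hle2
    rw [div_pow, le_div_iff₀ (by positivity)]
    have h2 : ω₀ ^ 2 * (N * ∑ k ∈ Finset.range N, (e (k + 1) - e k) ^ 2) ≤ η ^ 2 := by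
      refine le_of_mul_le_mul_left ?_ hN'
      calc _ = (ω₀ * N) ^ 2 * ∑ k ∈ Finset.range N, (e (k + 1) - e k) ^ 2 := by ring
        _ ≤ _ := hle2
    calc S ^ 2 * ω₀ ^ 2 ≤ (N * ∑ k ∈ Finset.range N, (e (k + 1) - e k) ^ 2) * ω₀ ^ 2 := by gcongr
      _ ≤ η ^ 2 := by linarith
  have hSle : S ≤ η / ω₀ := le_of_sq_le_sq hS2 (by positivity)
  obtain ⟨m, hm, hme⟩ : ∃ m ∈ Finset.range N, e m ^ 2 ≤ η ^ 2 := by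
    by_contra! hcon
    have := Finset.sum_lt_sum_of_nonempty (Finset.nonempty_range_iff.2 hN.ne') hcon
    simp at this
    linarith
  have hmη : |e m| ≤ η := abs_le_of_sq_le_sq hme hη
  have hdiff : ∀ a b : ℕ, a ≤ b → b ≤ N → |e a - e b| ≤ S := by
    intro a b hab hb
    have := dist_le_Ico_sum_dist (fun j : ℕ => e j) hab
    rw [Real.dist_eq] at this
    refine this.trans ((Finset.sum_le_sum_of_subset_of_nonneg (t := Finset.range N) ?_ ?_).trans
      (le_of_eq ?_))
    · intro j hj
      simp only [Finset.mem_Ico, Finset.mem_range] at hj ⊢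
      omega
    · intros
      positivity
    · refine Finset.sum_congr rfl fun j _ => ?_
      push_cast
      rw [Real.dist_eq, abs_sub_comm]
  have hper : e k = e ((k % N).toNat : ℕ) := by
    have h0 : (0 : ℤ) ≤ k % N := Int.emod_nonneg _ (by omega)
    have hpe : Function.Periodic e (N : ℤ) := hep
    have h1 := hpe.int_mul (k / N) (k % N)
    rw [Int.toNat_of_nonneg h0, ← h1]
    congr 1
    rw [mul_comm]
    exact (Int.emod_add_mul_ediv k N).symm
  have hlt : (k % N).toNat < N := by
    have := Int.emod_lt_of_pos k (by omega : (0 : ℤ) < N)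
    omega
  have hmN := Finset.mem_range.1 hm
  have hclose : |e ((k % N).toNat : ℕ) - e m| ≤ S := by
    rcases le_total (k % N).toNat m with h | h
    · exact hdiff _ _ h hmN.le
    · rw [abs_sub_comm]
      exact hdiff _ _ h hlt.le
  rw [hper]
  have htri := abs_sub_abs_le_abs_sub (e ((k % N).toNat : ℕ)) (e m)
  have : η * (1 + 1 / ω₀) = η + η / ω₀ := by ring
  linarith

end Energy

/-! ### Convergence of the chain to the wave in the Lagrangian coordinate. -/

section Convergence

theorem timeDeriv_eq {y : ℝ → ℝ} {y' t : ℝ} (ht : 0 ≤ t) (h : HasDerivWithinAt y y' (Ici 0) t) :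
    timeDeriv y t = y' :=
  h.derivWithin (uniqueDiffOn_Ici 0 t ht)

theorem IsChain.hasDerivWithinAt {N : ℕ} {L ω α : ℝ} {f : ℝ → ℝ} {x : ℤ → ℝ → ℝ}
    (hx : IsChain N L ω α f x) (k : ℤ) {t : ℝ} (ht : 0 ≤ t) :
    HasDerivWithinAt (x k) (timeDeriv (x k) t) (Ici 0) t :=
  (hx.differentiable k t ht).hasDerivWithinAt

theorem IsChain.timeDeriv_periodic {N : ℕ} {L ω α : ℝ} {f : ℝ → ℝ} {x : ℤ → ℝ → ℝ}
    (hx : IsChain N L ω α f x) (k : ℤ) {t : ℝ} (ht : 0 ≤ t) :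
    timeDeriv (x (k + N)) t = timeDeriv (x k) t :=
  timeDeriv_eq ht (((hx.hasDerivWithinAt k ht).add_const L).congr
    (fun s hs => hx.periodic k s hs) (hx.periodic k t ht))

theorem abs_le_of_abs_step_le {e : ℤ → ℝ} {a : ℝ} (h0 : e 0 = 0)
    (h : ∀ k : ℤ, |e (k + 1) - e k| ≤ a) (k : ℕ) : |e k| ≤ k * a := by
  induction k with
  | zero => simp [h0]
  | succ k ih =>
    have h1 := h k
    have h2 := abs_sub_abs_le_abs_sub (e (k + 1)) (e k)
    push_cast
    linarith

theorem abs_step_error_le {N : ℕ} (hN : 0 < N) {L B C y₀ y₁ I₀ I₁ J p : ℝ}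
    (hI : I₁ = I₀ + J)
    (hB : |J - L / N * p| ≤ B * (L / N) ^ 2)
    (hC : |y₁ - y₀ - L / N * p| < C / (N : ℝ) ^ 2) :
    |(y₁ - I₁) - (y₀ - I₀)| ≤ (C + B * L ^ 2) / (N : ℝ) ^ 2 := by
  have e : (y₁ - I₁) - (y₀ - I₀) = (y₁ - y₀ - L / N * p) - (J - L / N * p) := by
    rw [hI]; ring
  have e2 : (C + B * L ^ 2) / (N : ℝ) ^ 2 = C / (N : ℝ) ^ 2 + B * (L / N) ^ 2 := by
    have : (N : ℝ) ≠ 0 := by positivity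
    field_simp
  rw [e, e2]
  exact (abs_sub _ _).trans (add_le_add hC.le hB)

theorem integral_step {h : ℝ → ℝ} (hc : Continuous h) (N : ℕ) (L : ℝ) (k : ℤ) :
    ∫ u in (0 : ℝ)..(((k + 1 : ℤ) : ℝ) * L / N), h u =
      (∫ u in (0 : ℝ)..(k * L / N), h u) + ∫ u in (k * L / N : ℝ)..(k * L / N + L / N), h u := by
  rw [intervalIntegral.integral_add_adjacent_intervals (hc.intervalIntegrable _ _)
    (hc.intervalIntegrable _ _)]
  congr 1
  push_cast
  ring

/-- The errors vanish at particle 0 and grow by `O(1/N²)` per step, so they are `O(1/N)` over a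
period. The elastic term has the same order after multiplication by `(ω₀N)²`. -/
theorem initial_chainEnergy_le {N : ℕ} (hN : 0 < N) {ω₀ a b : ℝ}
    {e w : ℤ → ℝ} (he0 : e 0 = 0) (hw0 : w 0 = 0)
    (he : ∀ k : ℤ, |e (k + 1) - e k| ≤ a / (N : ℝ) ^ 2)
    (hw : ∀ k : ℤ, |w (k + 1) - w k| ≤ b / (N : ℝ) ^ 2) :
    chainEnergy N (ω₀ * N) e w ≤ N * ((a ^ 2 + b ^ 2 + ω₀ ^ 2 * a ^ 2) / (N : ℝ) ^ 2) := by
  have hN' : (0 : ℝ) < N := by exact_mod_cast hN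
  have hsmall : ∀ {g : ℤ → ℝ} {c : ℝ}, g 0 = 0 →
      (∀ k : ℤ, |g (k + 1) - g k| ≤ c / (N : ℝ) ^ 2) →
      ∀ k ∈ Finset.range N, g k ^ 2 ≤ c ^ 2 / (N : ℝ) ^ 2 := by
    intro g c h0 hg k hk
    have h1 := abs_le_of_abs_step_le h0 hg k
    have hc : 0 ≤ c / (N : ℝ) ^ 2 := (abs_nonneg _).trans (hg 0)
    have hk' : (k : ℝ) ≤ N := by exact_mod_cast (Finset.mem_range.1 hk).le
    have h2 : |g k| ≤ c / N := by
      refine h1.trans ((mul_le_mul_of_nonneg_right hk' hc).trans (le_of_eq ?_))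
      field_simp
    have := sq_le_sq' (by linarith [neg_abs_le (g k)]) ((le_abs_self (g k)).trans h2)
    rwa [div_pow] at this
  calc chainEnergy N (ω₀ * N) e w
      ≤ ∑ k ∈ Finset.range N, (a ^ 2 + b ^ 2 + ω₀ ^ 2 * a ^ 2) / (N : ℝ) ^ 2 := by
        refine Finset.sum_le_sum fun k hk => ?_
        have h1 := hsmall he0 he k hk
        have h2 := hsmall hw0 hw k hk
        have h3 : (e (k + 1) - e k) ^ 2 ≤ (a / (N : ℝ) ^ 2) ^ 2 :=
          sq_le_sq' (by linarith [(abs_le.1 (he k)).1]) (abs_le.1 (he k)).2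
        have h4 : (ω₀ * N) ^ 2 * (e (k + 1) - e k) ^ 2 ≤ ω₀ ^ 2 * a ^ 2 / (N : ℝ) ^ 2 := by
          refine (mul_le_mul_of_nonneg_left h3 (sq_nonneg _)).trans (le_of_eq ?_)
          field_simp
        rw [add_div, add_div]
        linarith
    _ = _ := by simp

/-- The particles of the chain stay close to the samples of the continuum solution. -/
theorem chain_sub_wave_le {N : ℕ} {L ω₀ α v C₁ C₂ A B r T η : ℝ} {f X V : ℝ → ℝ}
    {x : ℤ → ℝ → ℝ} {G Gt Gtt Gz Gzz : ℝ → ℝ → ℝ} (hL : 0 < L) (hω₀ : 0 < ω₀) (hα : 0 ≤ α)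
    (hX : Continuous X) (hV : Continuous V)
    (hx : IsChain N L (ω₀ * N) α f x) (hinit : FollowsProfile N L X V C₁ C₂ x)
    (hv : timeDeriv (x 0) 0 = v) (hG : IsDampedWave (ω₀ * L) α f G Gt Gtt Gz Gzz)
    (hG0 : ∀ z, G 0 z = ∫ u in (0 : ℝ)..z, X u) (hGt0 : ∀ z, Gt 0 z = v + ∫ u in (0 : ℝ)..z, V u)
    (hGL : ∀ t z, G t (z + L) = G t z + L)
    (hA : ∀ z s, 0 ≤ s → |(∫ u in z..(z + s), X u) - s * X z| ≤ A * s ^ 2)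
    (hB : ∀ z s, 0 ≤ s → |(∫ u in z..(z + s), V u) - s * V z| ≤ B * s ^ 2)
    (hr : ∀ t ∈ Icc 0 T, ∀ y z, |y - z| ≤ L / N → |Gzz t y - Gzz t z| ≤ r)
    (hη : 0 ≤ η)
    (hsmall : Real.exp (2 * T) * (((C₁ + A * L ^ 2) ^ 2 + (C₂ + B * L ^ 2) ^ 2 +
      ω₀ ^ 2 * (C₁ + A * L ^ 2) ^ 2) / (N : ℝ) ^ 2 + ((ω₀ * L) ^ 2 * r) ^ 2) ≤ η ^ 2)
    {t : ℝ} (ht : t ∈ Icc 0 T) (k : ℤ) :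
    |x k t - G t (k * L / N)| ≤ η * (1 + 1 / ω₀) := by
  have hN : 0 < N := hx.pos
  have hN' : (0 : ℝ) < N := by exact_mod_cast hN
  have hLN : 0 ≤ L / N := by positivity
  have hGtL : ∀ t z, Gt t (z + L) = Gt t z := fun t z => by
    have h1 := hG.hasDerivAt_t t (z + L)
    rw [show (fun s => G s (z + L)) = fun s => G s z + L from funext fun s => hGL s z] at h1
    exact h1.unique ((hG.hasDerivAt_t t z).add_const L)
  have hzN : ∀ k : ℤ, ((k + N : ℤ) : ℝ) * L / N = k * L / N + L := by
    intro k
    push_cast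
    field_simp
  set e : ℤ → ℝ → ℝ := fun k t => x k t - G t (k * L / N) with he
  set w : ℤ → ℝ → ℝ := fun k t => timeDeriv (x k) t - Gt t (k * L / N) with hw
  -- Consistency error of the scheme; `(ω₀N)² (L/N)² = (ω₀L)²` turns its last term into the one of
  -- the wave equation.
  set R : ℤ → ℝ → ℝ := fun k t => (ω₀ * N) ^ 2 * (G t (k * L / N + L / N) -
    2 * G t (k * L / N) + G t (k * L / N - L / N) - (L / N) ^ 2 * Gzz t (k * L / N)) with hRdef
  have hed : ∀ k t, 0 ≤ t → HasDerivWithinAt (e k) (w k t) (Ici 0) t := fun k t ht =>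
    (hx.hasDerivWithinAt k ht).sub (hG.hasDerivAt_t t _).hasDerivWithinAt
  have hwd : ∀ k t, 0 ≤ t → HasDerivWithinAt (w k)
      ((ω₀ * N) ^ 2 * (e (k + 1) t - 2 * e k t + e (k - 1) t) - α * w k t + R k t) (Ici 0) t := by
    intro k t ht
    refine ((hx.newton k t ht).sub (hG.hasDerivAt_tt t (k * L / N)).hasDerivWithinAt).congr_deriv ?_
    have e1 : ((k + 1 : ℤ) : ℝ) * L / N = k * L / N + L / N := by push_cast; ring
    have e2 : ((k - 1 : ℤ) : ℝ) * L / N = k * L / N - L / N := by push_cast; ring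
    have e3 : (ω₀ * N) ^ 2 * (L / N) ^ 2 = (ω₀ * L) ^ 2 := by field_simp
    simp only [he, hw, hRdef, hG.equation, e1, e2]
    linear_combination Gzz t (k * L / N) * e3
  have hep : ∀ k t, 0 ≤ t → e (k + N) t = e k t := by
    intro k t ht
    simp only [he, hzN, hGL, hx.periodic k t ht]
    ring
  have hwp : ∀ k t, 0 ≤ t → w (k + N) t = w k t := by
    intro k t ht
    simp only [hw, hzN, hGtL, hx.timeDeriv_periodic k ht]
  have hRr : ∀ k, ∀ t ∈ Icc 0 T, |R k t| ≤ (ω₀ * L) ^ 2 * r := by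
    intro k t ht
    have h1 := abs_second_difference_sub_le (hG.hasDerivAt_z t) (hG.hasDerivAt_zz t)
      (z := k * L / N) hLN (fun y hy => hr t ht y _ hy)
    rw [hRdef, abs_mul, abs_of_nonneg (sq_nonneg _)]
    refine (mul_le_mul_of_nonneg_left h1 (sq_nonneg _)).trans (le_of_eq ?_)
    field_simp
  have hstep1 : ∀ k : ℤ, |e (k + 1) 0 - e k 0| ≤ (C₁ + A * L ^ 2) / (N : ℝ) ^ 2 := by
    intro k
    simp only [he, hG0]
    exact abs_step_error_le hN (integral_step hX N L k) (hA _ _ hLN) (hinit.position k)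
  have hstep2 : ∀ k : ℤ, |w (k + 1) 0 - w k 0| ≤ (C₂ + B * L ^ 2) / (N : ℝ) ^ 2 := by
    intro k
    simp only [hw, hGt0]
    refine abs_step_error_le hN ?_ (hB _ _ hLN) (hinit.velocity k)
    rw [integral_step hV N L k, add_assoc]
  have he0 : e 0 0 = 0 := by simp [he, hG0, hx.initial_zero]
  have hw0 : w 0 0 = 0 := by simp [hw, hGt0, hv]
  have hE0 := initial_chainEnergy_le (ω₀ := ω₀) hN (e := fun k => e k 0) (w := fun k => w k 0)
    he0 hw0 hstep1 hstep2
  have hE := chainEnergy_le hα hed hwd hep hwp hRr ht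
  refine abs_le_of_chainEnergy_le hN hω₀ hη (e := fun k => e k t) (w := fun k => w k t)
    (fun k => hep k t ht.1) (hE.trans ?_) k
  have hexp : Real.exp (2 * t) ≤ Real.exp (2 * T) := Real.exp_le_exp.2 (by linarith [ht.2])
  refine (mul_le_mul_of_nonneg_left (add_le_add_left hE0 _) (Real.exp_pos _).le).trans ?_
  refine le_trans ?_ (mul_le_mul_of_nonneg_left hsmall hN'.le)
  rw [← mul_add, mul_left_comm]
  gcongr

theorem eventually_chain_close {L ω₀ α v C₁ C₂ : ℝ} {f X V : ℝ → ℝ}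
    {x : ℕ → ℤ → ℝ → ℝ} {G Gt Gtt Gz Gzz : ℝ → ℝ → ℝ} (hL : 0 < L) (hω₀ : 0 < ω₀) (hα : 0 ≤ α)
    (hXV : IsProfile L X V)
    (hchain : ∀ᶠ N : ℕ in atTop, IsChain N L (ω₀ * N) α f (x N))
    (hinit : ∀ᶠ N : ℕ in atTop, FollowsProfile N L X V C₁ C₂ (x N))
    (hv : ∀ᶠ N : ℕ in atTop, timeDeriv (x N 0) 0 = v)
    (hG : IsDampedWave (ω₀ * L) α f G Gt Gtt Gz Gzz)
    (hG0 : ∀ z, G 0 z = ∫ u in (0 : ℝ)..z, X u) (hGt0 : ∀ z, Gt 0 z = v + ∫ u in (0 : ℝ)..z, V u)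
    (hGL : ∀ t z, G t (z + L) = G t z + L) (T : ℝ) {ε : ℝ} (hε : 0 < ε) :
    ∀ᶠ N : ℕ in atTop, ∀ t ∈ Icc 0 T, ∀ k : ℤ, |x N k t - G t (k * L / N)| ≤ ε := by
  obtain ⟨A, hA0, hA⟩ := exists_integral_approx hL
    (hXV.contDiff_X.of_le (by norm_num)) hXV.periodic_X
  obtain ⟨B, hB0, hB⟩ := exists_integral_approx hL
    (hXV.contDiff_V.of_le (by norm_num)) hXV.periodic_V
  have hGzL : ∀ t z, Gz t (z + L) = Gz t z := fun t z => by
    have h1 := (hG.hasDerivAt_z t (z + L)).comp_add_const z L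
    rw [show (fun y => G t (y + L)) = fun y => G t y + L from funext fun y => hGL t y] at h1
    exact h1.unique ((hG.hasDerivAt_z t z).add_const L)
  have hGzzL : ∀ t, Function.Periodic (Gzz t) L := fun t z => by
    have h1 := (hG.hasDerivAt_zz t (z + L)).comp_add_const z L
    rw [show (fun y => Gz t (y + L)) = fun y => Gz t y from funext fun y => hGzL t y] at h1
    exact h1.unique (hG.hasDerivAt_zz t z)
  set η := ε / (1 + 1 / ω₀) with hηdef
  have hη : 0 < η := by positivity
  set D := (C₁ + A * L ^ 2) ^ 2 + (C₂ + B * L ^ 2) ^ 2 + ω₀ ^ 2 * (C₁ + A * L ^ 2) ^ 2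
  have hlim1 : Tendsto (fun r : ℝ => Real.exp (2 * T) * ((ω₀ * L) ^ 2 * r) ^ 2) (𝓝[>] 0) (𝓝 0) := by
    have : Continuous fun r : ℝ => Real.exp (2 * T) * ((ω₀ * L) ^ 2 * r) ^ 2 := by fun_prop
    have h := (this.tendsto 0).mono_left (nhdsWithin_le_nhds (s := Ioi 0))
    simpa using h
  -- The tolerance `r` for `Gzz` is fixed first, using half of `η²`; then `N` is taken large for the
  -- initial energy and for the modulus of continuity belonging to `r`.
  obtain ⟨r, hr1, hr0⟩ := ((hlim1.eventually_lt_const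
    (by positivity : (0 : ℝ) < η ^ 2 / 2)).and self_mem_nhdsWithin).exists
  have hlim2 : Tendsto (fun N : ℕ => Real.exp (2 * T) * (D / (N : ℝ) ^ 2)) atTop (𝓝 0) := by
    have h1 : Tendsto (fun N : ℕ => (N : ℝ) ^ 2) atTop atTop :=
      (tendsto_pow_atTop two_ne_zero).comp tendsto_natCast_atTop_atTop
    simpa using (h1.const_div_atTop D).const_mul (Real.exp (2 * T))
  have hlim3 : Tendsto (fun N : ℕ => L / (N : ℝ)) atTop (𝓝 0) :=
    tendsto_natCast_atTop_atTop.const_div_atTop L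
  obtain ⟨δ, hδ, hmod⟩ := exists_uniform_modulus hL hG.continuous_zz hGzzL T hr0
  filter_upwards [hchain, hinit, hv, hlim2.eventually_lt_const
    (by positivity : (0 : ℝ) < η ^ 2 / 2), hlim3.eventually_lt_const hδ] with N h1 h2 h3 h4 h5
  intro t ht k
  have key := chain_sub_wave_le hL hω₀ hα hXV.contDiff_X.continuous hXV.contDiff_V.continuous
    h1 h2 h3 hG hG0 hGt0 hGL hA hB
    (fun t ht y z hyz => hmod t ht y z (hyz.trans h5.le)) hη.le
    (by rw [mul_add]; linarith) ht k
  refine key.trans (le_of_eq ?_)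
  rw [hηdef]
  field_simp

end Convergence

/-! ### The change of variables between `x` and `z`. -/

section Coordinates

variable {L : ℝ} {X V : ℝ → ℝ}

theorem IsProfile.hasDerivAt_integral (hXV : IsProfile L X V) (z : ℝ) :
    HasDerivAt (fun z => ∫ u in (0 : ℝ)..z, X u) (X z) z :=
  (hXV.contDiff_X.continuous.integral_hasStrictDerivAt 0 z).hasDerivAt

/-- `m` is the minimum of `X` over a period. This bound gives bijectivity of `x(z)` and later turns
errors in position into errors in label. -/
theorem IsProfile.exists_pos_le (hL : 0 < L) (hXV : IsProfile L X V) :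
    ∃ m > 0, ∀ a b, a ≤ b →
      m * (b - a) ≤ (∫ u in (0 : ℝ)..b, X u) - ∫ u in (0 : ℝ)..a, X u := by
  have hc := hXV.contDiff_X.continuous
  obtain ⟨u₀, -, hu₀⟩ := isCompact_Icc.exists_isMinOn (nonempty_Icc.2 hL.le) hc.continuousOn
  have hmin : ∀ u, X u₀ ≤ X u := by
    intro u
    obtain ⟨y, hy, hyu⟩ := hXV.periodic_X.exists_mem_Ico₀ hL u
    rw [hyu]
    exact hu₀ (Ico_subset_Icc_self hy)
  refine ⟨X u₀, hXV.pos_X u₀, fun a b hab => ?_⟩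
  rw [intervalIntegral.integral_interval_sub_left (hc.intervalIntegrable _ _)
    (hc.intervalIntegrable _ _)]
  have := intervalIntegral.integral_mono_on (μ := MeasureTheory.volume) hab intervalIntegrable_const
    (hc.intervalIntegrable a b) (fun u _ => hmin u)
  rw [intervalIntegral.integral_const, smul_eq_mul, mul_comm] at this
  exact this

theorem IsProfile.strictMono_integral (hL : 0 < L) (hXV : IsProfile L X V) :
    StrictMono fun z => ∫ u in (0 : ℝ)..z, X u := by
  obtain ⟨m, hm, h⟩ := hXV.exists_pos_le hL
  intro a b hab
  have := h a b hab.le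
  have := mul_pos hm (sub_pos.2 hab)
  simp only
  linarith

theorem IsProfile.surjective_integral (hL : 0 < L) (hXV : IsProfile L X V) :
    Function.Surjective fun z => ∫ u in (0 : ℝ)..z, X u := by
  obtain ⟨m, hm, h⟩ := hXV.exists_pos_le hL
  have hcont : Continuous fun z => ∫ u in (0 : ℝ)..z, X u :=
    continuous_iff_continuousAt.2 fun z => (hXV.hasDerivAt_integral z).continuousAt
  refine hcont.surjective ?_ ?_
  · refine tendsto_atTop_mono' _ ?_ (tendsto_id.const_mul_atTop hm)
    filter_upwards [eventually_ge_atTop 0] with z hz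
    simpa using h 0 z hz
  · refine tendsto_atBot_mono' _ ?_ (tendsto_id.const_mul_atBot hm)
    filter_upwards [eventually_le_atBot 0] with z hz
    have := h z 0 hz
    simp only [zero_sub, intervalIntegral.integral_same] at this
    simp only [id]
    linarith

theorem IsProfile.integral_zOfX (hL : 0 < L) (hXV : IsProfile L X V) (y : ℝ) :
    ∫ u in (0 : ℝ)..zOfX X y, X u = y :=
  Function.rightInverse_invFun (hXV.surjective_integral hL) y

theorem IsProfile.zOfX_integral (hL : 0 < L) (hXV : IsProfile L X V) (z : ℝ) :
    zOfX X (∫ u in (0 : ℝ)..z, X u) = z :=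
  Function.leftInverse_invFun (hXV.strictMono_integral hL).injective z

theorem IsProfile.bijective_zOfX (hL : 0 < L) (hXV : IsProfile L X V) :
    Function.Bijective (zOfX X) :=
  ⟨Function.LeftInverse.injective (g := fun z => ∫ u in (0 : ℝ)..z, X u) (hXV.integral_zOfX hL),
    Function.RightInverse.surjective (hXV.zOfX_integral hL)⟩

theorem IsProfile.xOfZ_eq (hL : 0 < L) (hXV : IsProfile L X V) (z : ℝ) :
    xOfZ X z = ∫ u in (0 : ℝ)..z, X u := by
  refine (hXV.bijective_zOfX hL).1 ?_
  rw [hXV.zOfX_integral hL]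
  exact Function.rightInverse_invFun (hXV.bijective_zOfX hL).2 z

theorem IsProfile.zOfX_xOfZ (hL : 0 < L) (hXV : IsProfile L X V) (z : ℝ) :
    zOfX X (xOfZ X z) = z := by
  rw [hXV.xOfZ_eq hL, hXV.zOfX_integral hL]

theorem IsProfile.hasDerivAt_zOfX (hL : 0 < L) (hXV : IsProfile L X V) (y : ℝ) :
    HasDerivAt (zOfX X) (X (zOfX X y))⁻¹ y := by
  have hmono : StrictMono (zOfX X) := by
    intro a b hab
    rw [← (hXV.strictMono_integral hL).lt_iff_lt]
    simpa only [hXV.integral_zOfX hL] using hab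
  have hcont : Continuous (zOfX X) :=
    hmono.monotone.continuous_of_surjective (hXV.bijective_zOfX hL).2
  exact HasDerivAt.of_local_left_inverse hcont.continuousAt (hXV.hasDerivAt_integral _)
    (hXV.pos_X _).ne' (Eventually.of_forall (hXV.integral_zOfX hL))

/-- Bootstrapping: the derivative `1 / X(z(y))` is as smooth as `z` itself, within the smoothness of
`X`. -/
theorem IsProfile.contDiff_zOfX (hL : 0 < L) (hXV : IsProfile L X V) :
    ContDiff ℝ 2 (zOfX X) := by
  have hd := hXV.hasDerivAt_zOfX hL
  have hderiv : deriv (zOfX X) = fun y => (X (zOfX X y))⁻¹ := funext fun y => (hd y).deriv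
  have hstep : ∀ n : ℕ, n ≤ 4 → ContDiff ℝ n (zOfX X) → ContDiff ℝ (n + 1) (zOfX X) := by
    intro n hn h
    refine contDiff_succ_iff_deriv.2 ⟨fun y => (hd y).differentiableAt, by simp, ?_⟩
    rw [hderiv]
    exact ((hXV.contDiff_X.of_le (by exact_mod_cast hn)).comp h).inv fun y => (hXV.pos_X _).ne'
  have h0 : ContDiff ℝ (0 : ℕ) (zOfX X) :=
    contDiff_zero.2 (continuous_iff_continuousAt.2 fun y => (hd y).continuousAt)
  have h1 : ContDiff ℝ (1 : ℕ) (zOfX X) := by simpa using hstep 0 (by norm_num) h0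
  exact_mod_cast hstep 1 (by norm_num) h1

end Coordinates

/-! ### Partial derivatives of the wave in both coordinates. -/

section Derivatives

variable {ω α : ℝ} {f : ℝ → ℝ} {G Gt Gtt Gz Gzz : ℝ → ℝ → ℝ}

theorem IsDampedWave.Dt_eq (hG : IsDampedWave ω α f G Gt Gtt Gz Gzz) {t : ℝ} (ht : 0 ≤ t) (z : ℝ) :
    Dt G t z = Gt t z :=
  timeDeriv_eq ht (hG.hasDerivAt_t t z).hasDerivWithinAt

theorem IsDampedWave.Dtt_eq (hG : IsDampedWave ω α f G Gt Gtt Gz Gzz) {t : ℝ} (ht : 0 ≤ t)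
    (z : ℝ) : Dtt G t z = Gtt t z :=
  timeDeriv_eq ht ((hG.hasDerivAt_tt t z).hasDerivWithinAt.congr (fun _ hs => hG.Dt_eq hs z)
    (hG.Dt_eq ht z))

theorem IsDampedWave.Dx_eq (hG : IsDampedWave ω α f G Gt Gtt Gz Gzz) (t z : ℝ) :
    Dx G t z = Gz t z :=
  (hG.hasDerivAt_z t z).deriv

theorem IsDampedWave.Dxx_eq (hG : IsDampedWave ω α f G Gt Gtt Gz Gzz) (t z : ℝ) :
    Dxx G t z = Gzz t z := by
  unfold Dxx
  rw [funext (hG.Dx_eq t)]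
  exact (hG.hasDerivAt_zz t z).deriv

variable {L : ℝ} {X V : ℝ → ℝ}

theorem IsDampedWave.Dx_comp_zOfX (hG : IsDampedWave ω α f G Gt Gtt Gz Gzz) (hL : 0 < L)
    (hXV : IsProfile L X V) (t y : ℝ) :
    Dx (fun t y => G t (zOfX X y)) t y = Gz t (zOfX X y) * (X (zOfX X y))⁻¹ :=
  ((hG.hasDerivAt_z t (zOfX X y)).comp y (hXV.hasDerivAt_zOfX hL y)).deriv

/-- The second term comes from differentiating `1/X`. It is what `Y_x X'` cancels in `Y_xx X² + Y_x
X' = G_zz`. -/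
theorem IsDampedWave.Dxx_comp_zOfX (hG : IsDampedWave ω α f G Gt Gtt Gz Gzz) (hL : 0 < L)
    (hXV : IsProfile L X V) (t y : ℝ) :
    Dxx (fun t y => G t (zOfX X y)) t y = Gzz t (zOfX X y) * (X (zOfX X y))⁻¹ ^ 2 -
      Gz t (zOfX X y) * deriv X (zOfX X y) * (X (zOfX X y))⁻¹ ^ 3 := by
  unfold Dxx
  rw [funext (hG.Dx_comp_zOfX hL hXV t)]
  have hz := hXV.hasDerivAt_zOfX hL y
  have hXd : HasDerivAt X (deriv X (zOfX X y)) (zOfX X y) :=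
    ((hXV.contDiff_X.differentiable (by norm_num)) _).hasDerivAt
  have hpos := (hXV.pos_X (zOfX X y)).ne'
  have h1 := ((hG.hasDerivAt_zz t (zOfX X y)).comp y hz).mul ((hXd.comp y hz).inv hpos)
  refine (h1.congr_deriv ?_).deriv
  simp only [Function.comp, Pi.inv_apply]
  field_simp
  ring

end Derivatives

/-! ### From labels to initial positions. -/

section Limit

theorem isContinuumLimit_of_wave {L ω₀ α v C₁ C₂ : ℝ} {f X V : ℝ → ℝ}
    {x : ℕ → ℤ → ℝ → ℝ} {G Gt Gtt Gz Gzz : ℝ → ℝ → ℝ} (hL : 0 < L) (hω₀ : 0 < ω₀) (hα : 0 ≤ α)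
    (hXV : IsProfile L X V)
    (hchain : ∀ᶠ N : ℕ in atTop, IsChain N L (ω₀ * N) α f (x N))
    (hinit : ∀ᶠ N : ℕ in atTop, FollowsProfile N L X V C₁ C₂ (x N))
    (hv : ∀ᶠ N : ℕ in atTop, timeDeriv (x N 0) 0 = v)
    (hG : IsDampedWave (ω₀ * L) α f G Gt Gtt Gz Gzz)
    (hG0 : ∀ z, G 0 z = ∫ u in (0 : ℝ)..z, X u) (hGt0 : ∀ z, Gt 0 z = v + ∫ u in (0 : ℝ)..z, V u)
    (hGL : ∀ t z, G t (z + L) = G t z + L) :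
    IsContinuumLimit x fun t y => G t (zOfX X y) := by
  intro T hT
  rw [Metric.tendstoUniformlyOn_iff]
  intro ε hε
  obtain ⟨m, hm, hmle⟩ := hXV.exists_pos_le hL
  -- `G` is not periodic, but `G - z` is; the removed `z` costs a further `|y - z|`, hence the `ε /
  -- 4` in `d`.
  obtain ⟨δ, hδ, hmod⟩ := exists_uniform_modulus (h := fun t z => G t z - z) hL
    (hG.contDiff.continuous.sub continuous_snd)
    (fun t z => by simp only [hGL]; ring) T (by positivity : 0 < ε / 4)
  set d := min δ (ε / 4) with hd
  have hd0 : 0 < d := by positivity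
  -- As `x(z)` has slope at least `m`, an error `m * (d / 2)` in the initial position moves the
  -- label by at most `d / 2`. The particle spacing `L / N` uses the other half of `d`.
  have hclose := eventually_chain_close hL hω₀ hα hXV hchain hinit hv hG hG0 hGt0 hGL T
    (by positivity : 0 < min (ε / 4) (m * (d / 2)))
  have hlim : Tendsto (fun N : ℕ => L / (N : ℝ)) atTop (𝓝 0) :=
    tendsto_natCast_atTop_atTop.const_div_atTop L
  filter_upwards [hclose, hchain, hlim.eventually_lt_const (by positivity : 0 < d / 2)]
    with N h1 h2 h3
  rintro ⟨t, y⟩ ⟨ht, -⟩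
  obtain ⟨hk1, hk2⟩ := (h2.particleAt_spec y (particleAt (x N) y)).2 rfl
  set k := particleAt (x N) y
  have h0T : (0 : ℝ) ∈ Icc 0 T := ⟨le_rfl, hT.le⟩
  have ha := abs_le.1 ((h1 0 h0T k).trans (min_le_right _ _))
  have hb := abs_le.1 ((h1 0 h0T (k + 1)).trans (min_le_right _ _))
  rw [hG0] at ha hb
  have hy := hXV.integral_zOfX hL y
  have e1 : ((k + 1 : ℤ) : ℝ) * L / N = k * L / N + L / N := by push_cast; ring
  have hlow : k * L / N - zOfX X y ≤ d / 2 := by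
    by_contra! hcon
    have := hmle (zOfX X y) (k * L / N) (by linarith)
    have := mul_lt_mul_of_pos_left hcon hm
    linarith
  have hup : zOfX X y - (k * L / N + L / N) ≤ d / 2 := by
    by_contra! hcon
    have := hmle (k * L / N + L / N) (zOfX X y) (by linarith)
    have := mul_lt_mul_of_pos_left hcon hm
    rw [e1] at hb
    linarith
  have hLN : 0 ≤ L / N := by positivity
  have hdist : |zOfX X y - k * L / N| ≤ d := abs_le.2 ⟨by linarith, by linarith⟩
  have h4 := abs_le.1 (hmod t ht _ _ (hdist.trans (min_le_left _ _)))
  have h5 := abs_le.1 (hdist.trans (min_le_right _ _))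
  have h6 := abs_le.1 ((h1 t ht k).trans (min_le_left _ _))
  rw [Real.dist_eq, abs_lt]
  constructor <;> simp only <;> linarith

end Limit

end OscillatorChain

/-! ### The continuum limit theorem. -/

theorem mainTheorem9 (L ω₀ α v C₁ C₂ δ : ℝ) (f X V : ℝ → ℝ) (x : ℕ → ℤ → ℝ → ℝ)
    (hL : 0 < L) (hω₀ : 0 < ω₀) (hα : 0 ≤ α) (hC₁ : 0 < C₁) (hC₂ : 0 < C₂)
    (hδ₀ : 0 < δ) (hδ₁ : δ < 1)
    (hf : ContDiff ℝ 2 f)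
    (hXV : OscillatorChain.IsProfile L X V)
    (hγ : OscillatorChain.gammaConst L ω₀ α X V C₁ C₂ < δ)
    (hchain : ∀ᶠ N : ℕ in atTop, OscillatorChain.IsChain N L (ω₀ * N) α f (x N))
    (hinit : ∀ᶠ N : ℕ in atTop, OscillatorChain.FollowsProfile N L X V C₁ C₂ (x N))
    (hv : ∀ᶠ N : ℕ in atTop, OscillatorChain.timeDeriv (x N 0) 0 = v) :
    -- the maps `z(x)` and `x(z)` are well defined and inverse to each other
    (∀ y : ℝ, ∫ u in (0 : ℝ)..OscillatorChain.zOfX X y, X u = y) ∧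
    Function.LeftInverse (OscillatorChain.xOfZ X) (OscillatorChain.zOfX X) ∧
    Function.RightInverse (OscillatorChain.xOfZ X) (OscillatorChain.zOfX X) ∧
    -- the limit `Y` exists and satisfies the equations
    ∃ Y : ℝ → ℝ → ℝ,
      OscillatorChain.IsContinuumLimit x Y ∧
      OscillatorChain.IsC2 Y ∧
      OscillatorChain.IsC2 (OscillatorChain.lagrange X Y) ∧
      (∀ t : ℝ, 0 ≤ t → ∀ z : ℝ,
        OscillatorChain.Dtt Y t (OscillatorChain.xOfZ X z) =
          (ω₀ * L) ^ 2 *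
            (OscillatorChain.Dxx Y t (OscillatorChain.xOfZ X z) * X z ^ 2 +
              OscillatorChain.Dx Y t (OscillatorChain.xOfZ X z) * deriv X z) -
          α * OscillatorChain.Dt Y t (OscillatorChain.xOfZ X z) + f t) ∧
      (∀ z : ℝ,
        Y 0 (OscillatorChain.xOfZ X z) = OscillatorChain.xOfZ X z ∧
        OscillatorChain.xOfZ X z = ∫ u in (0 : ℝ)..z, X u ∧
        OscillatorChain.lagrange X Y 0 z = ∫ u in (0 : ℝ)..z, X u) ∧
      (∀ z : ℝ,
        OscillatorChain.Dt Y 0 (OscillatorChain.xOfZ X z) = v + ∫ u in (0 : ℝ)..z, V u) ∧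
      (∀ t : ℝ, 0 ≤ t → ∀ z : ℝ,
        OscillatorChain.Dtt (OscillatorChain.lagrange X Y) t z =
          (ω₀ * L) ^ 2 * OscillatorChain.Dxx (OscillatorChain.lagrange X Y) t z -
          α * OscillatorChain.Dt (OscillatorChain.lagrange X Y) t z + f t) ∧
      (α = 0 → (∀ t : ℝ, 0 ≤ t → f t = 0) →
        ((∀ t : ℝ, 0 ≤ t → ∀ y : ℝ,
            OscillatorChain.Dtt Y t y = (ω₀ * L) ^ 2 * OscillatorChain.Dxx Y t y) ↔
          ∀ u : ℝ, X u = 1)) := by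
  obtain ⟨G, Gt, Gtt, Gz, Gzz, hG, hG0, hGt0, hGL⟩ :=
    OscillatorChain.exists_dampedWave (ω := ω₀ * L) (α := α) (v := v) hf hXV
  have hxz := hXV.xOfZ_eq hL
  have hzx := hXV.zOfX_xOfZ hL
  have hlag : OscillatorChain.lagrange X (fun t y => G t (OscillatorChain.zOfX X y)) = G := by
    funext t z
    simp only [OscillatorChain.lagrange, hzx]
  refine ⟨hXV.integral_zOfX hL, fun y => ?_, hzx, fun t y => G t (OscillatorChain.zOfX X y),
    OscillatorChain.isContinuumLimit_of_wave hL hω₀ hα hXV hchain hinit hv hG hG0 hGt0 hGL,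
    ?_, ?_, ?_, ?_, ?_, ?_, ?_⟩
  · rw [hxz, hXV.integral_zOfX hL]
  · exact (hG.contDiff.comp
      (contDiff_fst.prodMk ((hXV.contDiff_zOfX hL).comp contDiff_snd))).contDiffOn
  · rw [hlag]
    exact hG.contDiff.contDiffOn
  · intro t ht z
    have hX := (hXV.pos_X z).ne'
    have h1 := hG.Dtt_eq ht z
    have h2 := hG.Dt_eq ht z
    rw [hG.Dxx_comp_zOfX hL hXV, hG.Dx_comp_zOfX hL hXV]
    change OscillatorChain.Dtt G t (OscillatorChain.zOfX X (OscillatorChain.xOfZ X z)) = _ -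
      α * OscillatorChain.Dt G t (OscillatorChain.zOfX X (OscillatorChain.xOfZ X z)) + f t
    rw [hzx, h1, h2, hG.equation]
    field_simp
    ring
  · intro z
    rw [hlag]
    simp only [hG0, hxz, hXV.zOfX_integral hL, and_self]
  · intro z
    change OscillatorChain.Dt G 0 (OscillatorChain.zOfX X (OscillatorChain.xOfZ X z)) = _
    rw [hzx, hG.Dt_eq le_rfl, hGt0]
  · intro t ht z
    rw [hlag, hG.Dtt_eq ht, hG.Dt_eq ht, hG.Dxx_eq, hG.equation]
  · intro hα0 hf0
    constructor
    · intro hwave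
      have hderiv : ∀ z, deriv X z = 0 := by
        intro z
        -- At `t = 0`, `Y` is the identity in `y`, so `Y_xx = 0`, while `Y_tt = ω₁² G_zz = ω₁² X'`.
        have h1 := hwave 0 le_rfl (OscillatorChain.xOfZ X z)
        change OscillatorChain.Dtt G 0 (OscillatorChain.zOfX X (OscillatorChain.xOfZ X z)) = _
          at h1
        have hGz : Gz 0 = X := by
          funext y
          refine (hG.hasDerivAt_z 0 y).unique ?_
          rw [funext hG0]
          exact hXV.hasDerivAt_integral y
        have hGzz : Gzz 0 z = deriv X z := by
          rw [← (hG.hasDerivAt_zz 0 z).deriv, hGz]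
        have hxx : OscillatorChain.Dxx (fun t y => G t (OscillatorChain.zOfX X y)) 0
            (OscillatorChain.xOfZ X z) = 0 := by
          have hid : (fun y => G 0 (OscillatorChain.zOfX X y)) = fun y => y := by
            funext y
            rw [hG0, hXV.integral_zOfX hL]
          simp [OscillatorChain.Dxx, OscillatorChain.Dx, hid]
        rw [hxx, hzx, hG.Dtt_eq le_rfl, hG.equation, hα0, hf0 0 le_rfl, hGzz] at h1
        have h2 : (ω₀ * L) ^ 2 ≠ 0 := by positivity
        simpa [h2] using h1
      have hconst : ∀ u, X u = X 0 := fun u =>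
        is_const_of_deriv_eq_zero (hXV.contDiff_X.differentiable (by norm_num)) hderiv u 0
      -- The mean of `X` over a period fixes the constant.
      have hint := hXV.integral_X
      rw [funext hconst, intervalIntegral.integral_const, sub_zero, smul_eq_mul] at hint
      intro u
      rw [hconst u]
      exact mul_left_cancel₀ hL.ne' (by linarith)
    · intro hX1 t ht y
      have hXd : ∀ u, deriv X u = 0 := by
        intro u
        rw [funext hX1, deriv_const]
      rw [hG.Dxx_comp_zOfX hL hXV, hXd, hX1]
      change OscillatorChain.Dtt G t (OscillatorChain.zOfX X y) = _
      rw [hG.Dtt_eq ht, hG.equation, hα0, hf0 t ht]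
      ring
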